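/- For a Borel probability measure $\mu$ on $\mathbb{R}$, say that $\mu$ satisfies a free Poincaré inequality with constant $C>0$ if \[ \iint \left(\frac{\phi(x)-\phi(y)}{x-y}\right)^2\mu(dx)\,\mu(dy)\;\ge\; C\,\mathrm{Var}_\mu(\phi) \] for every compactly supported $C^1$ function $\phi:\mathbb{R}\to\mathbb{R}$, where the quotient is read as $\phi'(x)$ when $x=y$ and $\mathrm{Var}_\mu(\phi)=\int\phi^2\,d\mu-\big(\int\phi\,d\mu\big)^2$. Let $\mathrm{Poin}(\mu)$ denote the largest such $C$. (1) Let $\mu$ be a probability measure with compact support that is not concentrated at one point. Then $\mu$ satisfies a free Poincaré inequality, the largest constant $\mathrm{Poin}(\mu)$ exists, and \[ \frac{2}{d(\mu)^2}\;\le\;\mathrm{Poin}(\mu)\;\le\;\frac{1}{\mathrm{Var}(\mu)}, \] where $d(\mu)$ is the diameter of the support of $\mu$ and $\mathrm{Var}(\mu)=\int x^2\mu(dx)-\big(\int x\,\mu(dx)\big)^2$. Equality holds on the left if and only if $\mu=\alpha\delta_a+(1-\alpha)\delta_b$ for some $a<b$ and $0<\alpha<1$. Equality holds on the right if and only if $\mu$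 is a semicircular law \[ \mu(dx)=\frac{1}{2\pi r^2}\,\mathbf{1}_{[a-2r,a+2r]}(x)\sqrt{4r^2-(x-a)^2}\,dx \] for some $a\in\mathbb{R}$ and $r>0$. (2) Let $V:\mathbb{R}\to\mathbb{R}$ be $C^2$ and such that $V(x)-\rho x^{2p}$ is convex for some integer $p\ge1$ and some real $\rho>0$, and let $\mu$ be a minimizer, over all probability measures on $\mathbb{R}$, of \[ E_V(\mu)=\int V(x)\,\mu(dx)-\iint\log|x-y|\,\mu(dx)\,\mu(dy), \] where $E_V(\mu)=+\infty$ if the two integrals are not both finite (with $\log 0=-\infty$; in particular if $\mu$ has atoms). Then $\mu$ satisfies a free Poincaré inequality, the largest constant $\mathrm{Poin}(\mu)$ exists, and \[ \mathrm{Poin}(\mu)\;\ge\;\frac{\left(p\,\rho\binom{2p}{p}\right)^{1/p}}{8}. \] In particular, $\mathrm{Poin}(\mu)\ge\rho/4$ if $p=1$. -/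

import Mathlib

open MeasureTheory ProbabilityTheory

namespace FreePoincare

/-- The free Poincaré inequality for `μ` with constant `C`, tested on compactly supported `C¹`
functions `φ`. The noncommutative derivative `D φ (x, y) = (φ x - φ y) / (x - y)` is `dslope φ x y`,
which takes the value `φ' x` on the diagonal `x = y`. -/
def PoincareInequality (μ : Measure ℝ) (C : ℝ) : Prop :=
  ∀ φ : ℝ → ℝ, ContDiff ℝ 1 φ → HasCompactSupport φ →
    C * variance φ μ ≤ ∫ z : ℝ × ℝ, (dslope φ z.1 z.2) ^ 2 ∂(μ.prod μ)

/-- The constants `C > 0` for which the free Poincaré inequality holds. -/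
def poincareConstants (μ : Measure ℝ) : Set ℝ :=
  {C : ℝ | 0 < C ∧ PoincareInequality μ C}

/-- `μ` satisfies a free Poincaré inequality. -/
def SatisfiesPoincare (μ : Measure ℝ) : Prop :=
  ∃ C : ℝ, 0 < C ∧ PoincareInequality μ C

/-- The best constant in the free Poincaré inequality. -/
noncomputable def Poin (μ : Measure ℝ) : ℝ :=
  sSup (poincareConstants μ)

/-- The semicircular law centred at `a` with variance `r ^ 2`, for `r > 0`. -/
noncomputable def semicircular (a r : ℝ) : Measure ℝ :=
  volume.withDensity fun x =>
    ENNReal.ofReal ((Set.Icc (a - 2 * r) (a + 2 * r)).indicator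
      (fun x => 1 / (2 * Real.pi * r ^ 2) * Real.sqrt (4 * r ^ 2 - (x - a) ^ 2)) x)

/-- A two-point measure `α δ_a + (1 - α) δ_b` with `a < b` and `0 < α < 1`. -/
def IsTwoPoint (μ : Measure ℝ) : Prop :=
  ∃ α a b : ℝ, 0 < α ∧ α < 1 ∧ a < b ∧
    μ = ENNReal.ofReal α • Measure.dirac a + ENNReal.ofReal (1 - α) • Measure.dirac b

/-- A semicircular law. -/
def IsSemicircular (μ : Measure ℝ) : Prop :=
  ∃ a r : ℝ, 0 < r ∧ μ = semicircular a r

/-- Both integrals `∫ V dμ` and `∬ log |x - y| dμ dμ` exist and are finite. Since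
`log |x - y| = -∞` for `x = y` whereas `Real.log 0 = 0`, the second one asks in addition that the
diagonal be a null set. -/
def HasFiniteEnergy (V : ℝ → ℝ) (μ : Measure ℝ) : Prop :=
  Integrable V μ ∧ (μ.prod μ) (Set.diagonal ℝ) = 0 ∧
    Integrable (fun z : ℝ × ℝ => Real.log |z.1 - z.2|) (μ.prod μ)

open Classical in
/-- The logarithmic energy `∫ V dμ - ∬ log |x - y| dμ dμ` with external field `V`; it is `+∞` when
the two integrals are not both finite. -/
noncomputable def logEnergy (V : ℝ → ℝ) (μ : Measure ℝ) : EReal :=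
  if HasFiniteEnergy V μ then
    (((∫ x, V x ∂μ) - ∫ z : ℝ × ℝ, Real.log |z.1 - z.2| ∂(μ.prod μ) : ℝ) : EReal)
  else ⊤

/-- `μ` minimizes the logarithmic energy over all probability measures on the real line. -/
def IsEquilibriumMeasure (V : ℝ → ℝ) (μ : Measure ℝ) : Prop :=
  IsProbabilityMeasure μ ∧
    ∀ ν : Measure ℝ, IsProbabilityMeasure ν → logEnergy V μ ≤ logEnergy V ν

end FreePoincare

namespace FreePoincare

section

/-! ### Difference quotients -/

/-! Write D φ for the difference quotient. Doubling the variance gives the double integral of (φ y -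
φ x)² = (y - x)² (D φ)², and |y - x| ≤ d on the support, whence the constant 2/d². A support point c
strictly between the extreme ones improves it, since a ball around c has positive mass and stays at
distance less than d from the whole support. For two atoms, a cubic with zero slope at both kills
the diagonal and saturates the bound.

The test function x gives the upper bound. For the semicircular law the rescaled U_n are orthonormal
and D U_n = (1/r) ∑ U_k ⊗ U_{n-1-k} (`chebU_sub`). Hence if φ = ∑ c_n U_n, the energy is r⁻² times
the squared Hilbert–Schmidt norm of the Hankel matrix (c_{k+l+1}), and its first column alone is the
variance. Conversely, if x is extremal, the first variation ∬ D ψ = Cov(x, ψ)/Var(x), tested on the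
U_n, is a recursion forcing ∫ U_n dμ = 0 for n ≥ 1. This determines μ.

For an equilibrium measure only the diameter 2r of the support has to be bounded. The effective
potential V - 2 ∫ log|x - y| μ(dy) equals a constant ℓ almost everywhere, is at most ℓ on the
support by semicontinuity, and, being convex in gaps, is at most ℓ on the convex hull. Let ω_h be
the arcsine law of half-width h with the centre of that hull. Its logarithmic potential is log(h/2)
on its interval and no smaller elsewhere. Integrating the contact inequality against ω_r, and
testing minimality against ω_{sr}, give ∫ V dω_r - 2 log(r/2) ≤ ℓ ≤ ∫ V dω_{sr} - 2 log(sr/2).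
Convexity of V - ρx^{2p} bounds ∫ V dω_r - ∫ V dω_{sr} below by its value for the pure power, and s
→ 1 yields p ρ r^{2p} binom(2p, p)/4^p ≤ 1 (`IsEquilibriumMeasure.half_diam_pow_le`). The bound 2/d²
then concludes. -/

theorem dslope_eq_integral {φ : ℝ → ℝ} (hφ : ContDiff ℝ 1 φ) (x y : ℝ) :
    dslope φ x y = ∫ t in (0 : ℝ)..1, deriv φ (x + t * (y - x)) := by
  rcases eq_or_ne y x with rfl | h
  · simp
  · have hd : Continuous (deriv φ) := hφ.continuous_deriv le_rfl
    have := intervalIntegral.integral_unitInterval_deriv_eq_sub (𝕜 := ℝ) (f := φ)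
      (f' := deriv φ) (z₀ := x) (z₁ := y - x) (by fun_prop)
      (fun t _ => (hφ.differentiable one_ne_zero _).hasDerivAt)
    have h' : y - x ≠ 0 := sub_ne_zero.2 h
    simp only [smul_eq_mul, add_sub_cancel] at this
    rw [dslope_of_ne _ h, slope_def_field, ← this]
    field_simp

/-- The integral form involves no division, so continuity across the diagonal is immediate. It makes
D φ bounded on compact squares, hence integrable there. -/
theorem continuous_dslope {φ : ℝ → ℝ} (hφ : ContDiff ℝ 1 φ) :
    Continuous fun z : ℝ × ℝ => dslope φ z.1 z.2 := by
  have hd : Continuous (deriv φ) := hφ.continuous_deriv le_rfl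
  simp_rw [dslope_eq_integral hφ]
  apply intervalIntegral.continuous_parametric_intervalIntegral_of_continuous'
  simp only [Function.uncurry_def]
  fun_prop

theorem sub_mul_dslope (φ : ℝ → ℝ) (x y : ℝ) : (y - x) * dslope φ x y = φ y - φ x := by
  simpa using sub_smul_dslope φ x y

/-- A continuous factor in `φ y - φ x = (y - x) * S y` is the difference quotient. -/
theorem dslope_eq_of_factor {φ S : ℝ → ℝ} {x : ℝ} (hS : ContinuousAt S x)
    (h : ∀ y, φ y - φ x = (y - x) * S y) (y : ℝ) : dslope φ x y = S y := by
  have hne : ∀ y, y ≠ x → slope φ x y = S y := fun y hy => by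
    have := sub_ne_zero.2 hy
    rw [slope_def_field, h]
    field_simp
  rcases eq_or_ne y x with rfl | hy
  · rw [dslope_same]
    refine HasDerivAt.deriv (hasDerivAt_iff_tendsto_slope.2 ?_)
    refine (hS.tendsto.mono_left nhdsWithin_le_nhds).congr' ?_
    filter_upwards [self_mem_nhdsWithin] with z hz using (hne z hz).symm
  · rw [dslope_of_ne _ hy, hne y hy]

/-! ### Measures carried by a compact set -/

variable {μ : Measure ℝ} {K : Set ℝ}

theorem integrable_of_continuous_of_ae_mem {X : Type*} [TopologicalSpace X] [T2Space X]
    [MeasurableSpace X] [OpensMeasurableSpace X] {μ : Measure X} [IsFiniteMeasure μ] {K : Set X}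
    (hK : IsCompact K) (hμ : ∀ᵐ x ∂μ, x ∈ K) {f : X → ℝ} (hf : Continuous f) :
    Integrable f μ := by
  have := hf.continuousOn.integrableOn_compact (μ := μ) hK
  rwa [IntegrableOn, Measure.restrict_eq_self_of_ae_mem hμ] at this

theorem memLp_of_continuous_of_ae_mem [IsFiniteMeasure μ]
    (hK : IsCompact K) (hμ : ∀ᵐ x ∂μ, x ∈ K) {f : ℝ → ℝ} (hf : Continuous f) :
    MemLp f 2 μ :=
  (memLp_two_iff_integrable_sq hf.aestronglyMeasurable).2
    (integrable_of_continuous_of_ae_mem hK hμ (by fun_prop))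

theorem ae_prod_mem {ν : Measure ℝ} {s t : Set ℝ} [SFinite ν] (hμ : ∀ᵐ x ∂μ, x ∈ s)
    (hν : ∀ᵐ x ∂ν, x ∈ t) : ∀ᵐ z ∂(μ.prod ν), z ∈ s ×ˢ t := by
  filter_upwards [Measure.quasiMeasurePreserving_fst.ae hμ,
    Measure.quasiMeasurePreserving_snd.ae hν] with z h1 h2 using ⟨h1, h2⟩

theorem variance_eq_double_integral [IsProbabilityMeasure μ] (hK : IsCompact K)
    (hμ : ∀ᵐ x ∂μ, x ∈ K) {φ : ℝ → ℝ} (hφ : Continuous φ) :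
    2 * variance φ μ = ∫ z : ℝ × ℝ, (φ z.2 - φ z.1) ^ 2 ∂(μ.prod μ) := by
  have hL := memLp_of_continuous_of_ae_mem hK hμ hφ
  have h1 : Integrable φ μ := integrable_of_continuous_of_ae_mem hK hμ hφ
  have h2 : Integrable (fun x => φ x ^ 2) μ :=
    integrable_of_continuous_of_ae_mem hK hμ (by fun_prop)
  have e : ∀ z : ℝ × ℝ, (φ z.2 - φ z.1) ^ 2 = φ z.2 ^ 2 + φ z.1 ^ 2 - 2 * (φ z.1 * φ z.2) := by
    intro z; ring
  simp_rw [e]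
  have h3 : Integrable (fun z : ℝ × ℝ => φ z.2 ^ 2 + φ z.1 ^ 2) (μ.prod μ) :=
    (h2.comp_snd μ).add (h2.comp_fst μ)
  rw [integral_sub h3 ((h1.mul_prod h1).const_mul 2),
    integral_add (h2.comp_snd μ) (h2.comp_fst μ), integral_const_mul, integral_prod_mul,
    integral_fun_snd (fun x => φ x ^ 2), integral_fun_fst (fun x => φ x ^ 2), variance_eq_sub hL]
  simp only [probReal_univ, one_smul, Pi.pow_apply]
  ring

theorem integrable_dslope_sq [IsFiniteMeasure μ] (hK : IsCompact K) (hμ : ∀ᵐ x ∂μ, x ∈ K)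
    {φ : ℝ → ℝ} (hφ : ContDiff ℝ 1 φ) :
    Integrable (fun z : ℝ × ℝ => dslope φ z.1 z.2 ^ 2) (μ.prod μ) :=
  integrable_of_continuous_of_ae_mem (hK.prod hK) (ae_prod_mem hμ hμ)
    ((continuous_dslope hφ).pow 2)

/-- On a compactly supported measure, the Poincaré inequality extends to all `C¹` functions. -/
theorem PoincareInequality.of_contDiff {C : ℝ} (h : PoincareInequality μ C) [SFinite μ]
    (hK : IsCompact K) (hμ : ∀ᵐ x ∂μ, x ∈ K) {ψ : ℝ → ℝ} (hψ : ContDiff ℝ 1 ψ) :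
    C * variance ψ μ ≤ ∫ z : ℝ × ℝ, (dslope ψ z.1 z.2) ^ 2 ∂(μ.prod μ) := by
  obtain ⟨R, hR, hKR⟩ := hK.isBounded.subset_ball_lt 0 0
  let χ : ContDiffBump (0 : ℝ) := ⟨R, R + 1, hR, by linarith⟩
  -- The cutoff is 1 near every point of `K`, not merely on `K`, so the derivatives on the diagonal
  -- agree as well.
  have heq : ∀ x ∈ K, (fun y => χ y * ψ y) =ᶠ[nhds x] ψ := by
    intro x hx
    filter_upwards [Metric.isOpen_ball.mem_nhds (hKR hx)] with y hy
    rw [χ.one_of_mem_closedBall (Metric.ball_subset_closedBall hy), one_mul]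
  have hmain := h (fun y => χ y * ψ y) (χ.contDiff.mul hψ) χ.hasCompactSupport.mul_right
  have hv : variance (fun y => χ y * ψ y) μ = variance ψ μ := by
    apply variance_congr
    filter_upwards [hμ] with x hx using (heq x hx).eq_of_nhds
  have hi : ∫ z : ℝ × ℝ, (dslope (fun y => χ y * ψ y) z.1 z.2) ^ 2 ∂(μ.prod μ)
      = ∫ z : ℝ × ℝ, (dslope ψ z.1 z.2) ^ 2 ∂(μ.prod μ) := by
    apply integral_congr_ae
    filter_upwards [ae_prod_mem hμ hμ] with z hz
    have h1 := heq z.1 hz.1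
    have h2 := heq z.2 hz.2
    rcases eq_or_ne z.2 z.1 with e | e
    · simp only [e, dslope_same, h1.deriv_eq]
    · simp only [dslope_of_ne _ e, slope_def_field, h1.eq_of_nhds, h2.eq_of_nhds]
  rwa [hv, hi] at hmain

theorem contDiff_of_polynomial (q : Polynomial ℝ) : ContDiff ℝ 1 fun x => q.eval x := by
  simpa [Polynomial.aeval_def] using q.contDiff_aeval (𝕜 := ℝ) 1

end

section

/-! ### The best constant and its bounds -/

variable {μ : Measure ℝ} {K : Set ℝ}

/-- Each test function imposes a closed condition on C, so the supremum is attained once it is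
finite. A single ψ of positive variance bounds the constants above and rules out the default value
of `sSup`. -/
theorem isGreatest_poin [IsProbabilityMeasure μ] (hK : IsCompact K) (hμ : ∀ᵐ x ∂μ, x ∈ K)
    (hs : SatisfiesPoincare μ) {ψ : ℝ → ℝ} (hψ : ContDiff ℝ 1 ψ) (hv : 0 < variance ψ μ) :
    IsGreatest (poincareConstants μ) (Poin μ) := by
  have hne : (poincareConstants μ).Nonempty := hs
  have hbdd : BddAbove (poincareConstants μ) := by
    refine ⟨(∫ z : ℝ × ℝ, (dslope ψ z.1 z.2) ^ 2 ∂(μ.prod μ)) / variance ψ μ, fun C hC => ?_⟩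
    rw [le_div_iff₀ hv]
    exact hC.2.of_contDiff hK hμ hψ
  refine ⟨⟨?_, fun φ hφ hc => ?_⟩, fun C hC => le_csSup hbdd hC⟩
  · obtain ⟨C, hC⟩ := hne
    exact hC.1.trans_le (le_csSup hbdd hC)
  · rcases (variance_nonneg φ μ).eq_or_lt with h0 | h0
    · rw [← h0, mul_zero]
      exact integral_nonneg fun z => sq_nonneg _
    · rw [← le_div_iff₀ h0]
      refine csSup_le hne fun C hC => ?_
      rw [le_div_iff₀ h0]
      exact hC.2 φ hφ hc

theorem eq_dirac_of_ae_eq [IsProbabilityMeasure μ] {a : ℝ} (h : ∀ᵐ x ∂μ, x = a) :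
    μ = Measure.dirac a := by
  have h1 : μ.restrict {a} = μ := Measure.restrict_eq_self_of_ae_mem h
  rw [Measure.restrict_singleton] at h1
  have h2 : μ {a} = 1 := by
    rw [← measure_univ (μ := μ)]
    refine measure_congr ?_
    filter_upwards [h] with x hx using propext ⟨fun _ => trivial, fun _ => hx⟩
  rw [← h1, h2, one_smul]

theorem variance_id_pos [IsProbabilityMeasure μ] (hK : IsCompact K) (hμ : ∀ᵐ x ∂μ, x ∈ K)
    (hd : ∀ a : ℝ, μ ≠ Measure.dirac a) : 0 < variance (fun x : ℝ => x) μ := by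
  refine (variance_nonneg _ _).lt_of_ne' fun h0 => hd (∫ x, x ∂μ) (eq_dirac_of_ae_eq ?_)
  have hi : Integrable (fun x => (x - ∫ y, y ∂μ) ^ 2) μ :=
    integrable_of_continuous_of_ae_mem hK hμ (by fun_prop)
  rw [variance_eq_integral measurable_id'.aemeasurable,
    integral_eq_zero_iff_of_nonneg (fun x => sq_nonneg _) hi] at h0
  filter_upwards [h0] with x hx
  simpa [sub_eq_zero] using hx

/-- The two factors of `(φ y - φ x) ^ 2 = (y - x) ^ 2 * (D φ) ^ 2`. -/
theorem div_le_dslope_sq (φ : ℝ → ℝ) {x y d : ℝ} (hd : 0 < d) (h : |y - x| ≤ d) :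
    (φ y - φ x) ^ 2 / d ^ 2 ≤ dslope φ x y ^ 2 := by
  rw [div_le_iff₀ (by positivity), ← sub_mul_dslope, mul_pow, mul_comm]
  exact mul_le_mul_of_nonneg_left (sq_le_sq' (neg_le_of_abs_le h) (le_of_abs_le h)) (sq_nonneg _)

theorem poincareInequality_two_div_sq [IsProbabilityMeasure μ] (hK : IsCompact K)
    (hμ : ∀ᵐ x ∂μ, x ∈ K) {d : ℝ} (hd : 0 < d) (hKd : ∀ x ∈ K, ∀ y ∈ K, |y - x| ≤ d) :
    PoincareInequality μ (2 / d ^ 2) := by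
  intro φ hφ _
  have h1 : 2 / d ^ 2 * variance φ μ = ∫ z : ℝ × ℝ, (φ z.2 - φ z.1) ^ 2 / d ^ 2 ∂(μ.prod μ) := by
    rw [integral_div, ← variance_eq_double_integral hK hμ hφ.continuous]
    ring
  rw [h1]
  have hc := hφ.continuous
  refine integral_mono_ae (integrable_of_continuous_of_ae_mem (hK.prod hK) (ae_prod_mem hμ hμ)
    (by fun_prop)) (integrable_dslope_sq hK hμ hφ) ?_
  filter_upwards [ae_prod_mem hμ hμ] with z hz
  exact div_le_dslope_sq φ hd (hKd _ hz.1 _ hz.2)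

/-- If a set of positive mass stays at distance at most `e < d` from the whole support, the constant
`2 / d ^ 2` can be improved. -/
theorem poincareInequality_two_div_sq_add [IsProbabilityMeasure μ] (hK : IsCompact K)
    (hμ : ∀ᵐ x ∂μ, x ∈ K) {d e : ℝ} (he : 0 < e) (hed : e ≤ d)
    (hKd : ∀ x ∈ K, ∀ y ∈ K, |y - x| ≤ d) {U : Set ℝ} (hU : MeasurableSet U)
    (hUe : ∀ x ∈ U, x ∈ K → ∀ y ∈ K, |y - x| ≤ e) :
    PoincareInequality μ (2 / d ^ 2 + (1 / e ^ 2 - 1 / d ^ 2) * μ.real U) := by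
  intro φ hφ _
  have hc := hφ.continuous
  set κ := 1 / e ^ 2 - 1 / d ^ 2 with hκ
  have hκ0 : 0 ≤ κ := sub_nonneg.2 (one_div_le_one_div_of_le (by positivity) (by gcongr))
  have hF : Integrable (fun z : ℝ × ℝ => (φ z.2 - φ z.1) ^ 2) (μ.prod μ) :=
    integrable_of_continuous_of_ae_mem (hK.prod hK) (ae_prod_mem hμ hμ) (by fun_prop)
  have hFU : Integrable (fun z : ℝ × ℝ => (U ×ˢ Set.univ).indicator
      (fun z : ℝ × ℝ => (φ z.2 - φ z.1) ^ 2) z) (μ.prod μ) :=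
    hF.indicator (hU.prod MeasurableSet.univ)
  -- For fixed x the mean of (φ - φ x)² is at least the variance, which is the least mean square
  -- over all constants. Integrate this over x in `U`.
  have h1 : μ.real U * variance φ μ ≤ ∫ z : ℝ × ℝ, (U ×ˢ Set.univ).indicator
      (fun z : ℝ × ℝ => (φ z.2 - φ z.1) ^ 2) z ∂(μ.prod μ) := by
    rw [integral_prod _ hFU]
    have e1 : μ.real U * variance φ μ = ∫ x, U.indicator (fun _ => variance φ μ) x ∂μ := by
      rw [integral_indicator_const _ hU, smul_eq_mul]
    rw [e1]
    refine integral_mono ((integrable_const _).indicator hU) hFU.integral_prod_left fun x => ?_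
    by_cases hx : x ∈ U
    · simp only [Set.indicator, Set.mem_prod, hx, Set.mem_univ, and_true,
        if_true]
      rw [← variance_sub_const hc.aestronglyMeasurable (φ x)]
      exact variance_le_expectation_sq (by fun_prop)
    · simp [Set.indicator, hx]
  -- The squared increment may be weighted by 1/e² when the first point is in `U` and by 1/d²
  -- otherwise; κ is the excess.
  have h2 : (2 / d ^ 2 + κ * μ.real U) * variance φ μ ≤ ∫ z : ℝ × ℝ,
      ((φ z.2 - φ z.1) ^ 2 / d ^ 2 + κ * (U ×ˢ Set.univ).indicator
      (fun z : ℝ × ℝ => (φ z.2 - φ z.1) ^ 2) z) ∂(μ.prod μ) := by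
    rw [integral_add (hF.div_const _) (hFU.const_mul κ), integral_div, integral_const_mul,
      ← variance_eq_double_integral hK hμ hc]
    have := mul_le_mul_of_nonneg_left h1 hκ0
    linarith [show (2 / d ^ 2 + κ * μ.real U) * variance φ μ
      = 2 * variance φ μ / d ^ 2 + κ * (μ.real U * variance φ μ) by ring]
  refine h2.trans (integral_mono_ae ((hF.div_const _).add (hFU.const_mul κ))
    (integrable_dslope_sq hK hμ hφ) ?_)
  filter_upwards [ae_prod_mem hμ hμ] with z hz
  by_cases hx : z.1 ∈ U
  · have := div_le_dslope_sq φ he (hUe _ hx hz.1 _ hz.2)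
    refine le_trans (le_of_eq ?_) this
    simp only [Set.indicator, Set.mem_prod, hx, Set.mem_univ, and_true, if_true, hκ]
    ring
  · have := div_le_dslope_sq φ (he.trans_le hed) (hKd _ hz.1 _ hz.2)
    simpa [Set.indicator, hx] using this

theorem poin_le_inv_variance [IsProbabilityMeasure μ] (hK : IsCompact K) (hμ : ∀ᵐ x ∂μ, x ∈ K)
    (hv : 0 < variance (fun x : ℝ => x) μ) {C : ℝ} (hC : PoincareInequality μ C) :
    C ≤ 1 / variance (fun x : ℝ => x) μ := by
  have := hC.of_contDiff hK hμ contDiff_id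
  have h1 : ∀ z : ℝ × ℝ, dslope (id : ℝ → ℝ) z.1 z.2 = 1 := fun z =>
    dslope_eq_of_factor (S := fun _ => 1) continuousAt_const (by simp) z.2
  simp only [h1, one_pow, integral_const, probReal_univ, smul_eq_mul, mul_one] at this
  rwa [le_div_iff₀ hv]

/-! ### Equality in the lower bound -/

theorem diam_support [IsProbabilityMeasure μ] (hc : IsCompact μ.support) :
    ∃ α β, α ∈ μ.support ∧ β ∈ μ.support ∧ μ.support ⊆ Set.Icc α β ∧
      Metric.diam μ.support = β - α := by
  have hne : μ.support.Nonempty := Measure.nonempty_support (IsProbabilityMeasure.ne_zero μ)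
  exact ⟨sInf μ.support, sSup μ.support, hc.sInf_mem hne, hc.sSup_mem hne,
    fun x hx => ⟨csInf_le hc.bddBelow hx, le_csSup hc.bddAbove hx⟩, Real.diam_eq hc.isBounded⟩

theorem isTwoPoint_of_support_subset [IsProbabilityMeasure μ] {a b : ℝ} (hab : a < b)
    (ha : a ∈ μ.support) (hb : b ∈ μ.support) (hs : μ.support ⊆ {a, b}) : IsTwoPoint μ := by
  have hae : ∀ᵐ x ∂μ, x ∈ ({a, b} : Set ℝ) := by
    filter_upwards [Measure.support_mem_ae (μ := μ)] with x hx using hs hx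
  have h0 : μ.restrict ({a} ∪ {b}) = μ := Measure.restrict_eq_self_of_ae_mem hae
  have hdis : Disjoint ({a} : Set ℝ) {b} := by simp [hab.ne]
  rw [Measure.restrict_union hdis (measurableSet_singleton b), Measure.restrict_singleton,
    Measure.restrict_singleton] at h0
  have pos : ∀ c ∈ μ.support, ∀ c', c' ≠ c → (∀ x ∈ ({a, b} : Set ℝ), x = c ∨ x = c') →
      μ {c} ≠ 0 := by
    intro c hc c' hne hx hz
    have := (Measure.mem_support_iff_forall c).1 hc {c'}ᶜ (isOpen_compl_singleton.mem_nhds hne.symm)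
    refine this.ne' (measure_mono_null (t := {c} ∪ {a, b}ᶜ) (fun x hx' => ?_)
      (measure_union_null hz hae))
    by_cases h : x ∈ ({a, b} : Set ℝ)
    · exact Or.inl ((hx x h).resolve_right hx')
    · exact Or.inr h
  have pa := pos a ha b hab.ne' (by simp)
  have pb := pos b hb a hab.ne (by simp [or_comm])
  have hsum : μ.real {a} + μ.real {b} = 1 := by
    rw [← measureReal_union hdis (measurableSet_singleton b), ← probReal_univ (μ := μ)]
    exact measureReal_congr (by filter_upwards [hae] with x hx; exact propext ⟨fun _ => trivial,
      fun _ => hx⟩)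
  have ra : 0 < μ.real {a} := ENNReal.toReal_pos pa (measure_ne_top _ _)
  have rb : 0 < μ.real {b} := ENNReal.toReal_pos pb (measure_ne_top _ _)
  refine ⟨μ.real {a}, a, b, ra, by linarith, hab, ?_⟩
  rw [← eq_sub_of_add_eq' hsum, ofReal_measureReal, ofReal_measureReal, h0]

/-- By compactness the largest distance from c to the support is attained, hence is less than d.
Half of the remaining gap serves as the radius of a ball around c. -/
theorem exists_poincareInequality_gt [IsProbabilityMeasure μ] (hc : IsCompact μ.support) {d c : ℝ}
    (hKd : ∀ x ∈ μ.support, ∀ y ∈ μ.support, |y - x| ≤ d) (hcK : c ∈ μ.support)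
    (hcd : ∀ y ∈ μ.support, |y - c| < d) : ∃ C, 2 / d ^ 2 < C ∧ PoincareInequality μ C := by
  have hne : μ.support.Nonempty := ⟨c, hcK⟩
  obtain ⟨y₀, hy₀, hmax⟩ := hc.exists_isMaxOn hne
    (f := fun y => |y - c|) (by fun_prop)
  have hlt := hcd y₀ hy₀
  set δ := (d - |y₀ - c|) / 2 with hδ
  have hδ0 : 0 < δ := by linarith
  have he : 0 < |y₀ - c| + δ := by positivity
  have hed : |y₀ - c| + δ < d := by linarith
  have hU : 0 < μ.real (Metric.ball c δ) := ENNReal.toReal_pos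
    ((Measure.mem_support_iff_forall c).1 hcK _ (Metric.ball_mem_nhds c hδ0)).ne'
    (measure_ne_top _ _)
  refine ⟨_, ?_, poincareInequality_two_div_sq_add hc Measure.support_mem_ae he hed.le hKd
    Metric.isOpen_ball.measurableSet (U := Metric.ball c δ) fun x hx _ y hy => ?_⟩
  · have : 0 < 1 / (|y₀ - c| + δ) ^ 2 - 1 / d ^ 2 :=
      sub_pos.2 (one_div_lt_one_div_of_lt (by positivity) (by gcongr))
    have := mul_pos this hU
    linarith
  · have h1 : |y - c| ≤ |y₀ - c| := hmax hy
    rw [Metric.mem_ball', Real.dist_eq] at hx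
    calc |y - x| = |(y - c) + (c - x)| := by ring_nf
      _ ≤ |y - c| + |c - x| := abs_add_le _ _
      _ ≤ _ := by linarith

theorem support_twoPoint {α a b : ℝ} (h0 : 0 < α) (h1 : α < 1) :
    (ENNReal.ofReal α • Measure.dirac a + ENNReal.ofReal (1 - α) • Measure.dirac b).support
      = {a, b} := by
  apply Set.Subset.antisymm
  · refine Measure.support_subset_of_isClosed (Set.toFinite _).isClosed ?_
    rw [mem_ae_iff]
    simp
  · intro x hx
    rw [Measure.mem_support_iff_forall]
    intro U hU
    rcases hx with rfl | rfl
    · simp [mem_of_mem_nhds hU, h0]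
    · simp [mem_of_mem_nhds hU, h1]

theorem le_of_poincareInequality_twoPoint {α a b C : ℝ} (h0 : 0 < α) (h1 : α < 1) (hab : a < b)
    (h : PoincareInequality
      (ENNReal.ofReal α • Measure.dirac a + ENNReal.ofReal (1 - α) • Measure.dirac b) C) :
    C ≤ 2 / (b - a) ^ 2 := by
  set μ := ENNReal.ofReal α • Measure.dirac a + ENNReal.ofReal (1 - α) • Measure.dirac b with hμ
  have hint : ∀ f : ℝ → ℝ, ∫ x, f x ∂μ = α * f a + (1 - α) * f b := by
    intro f
    have hd : ∀ c : ℝ, Integrable f (Measure.dirac c) := fun c => integrable_dirac (by simp)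
    rw [hμ, integral_add_measure ((hd a).smul_measure (by simp)) ((hd b).smul_measure (by simp)),
      integral_smul_measure, integral_smul_measure, integral_dirac, integral_dirac,
      ENNReal.toReal_ofReal h0.le, ENNReal.toReal_ofReal (by linarith), smul_eq_mul, smul_eq_mul]
  have hp : IsProbabilityMeasure μ := ⟨by
    simp [hμ, ← ENNReal.ofReal_add h0.le (sub_nonneg.2 h1.le)]⟩
  have hae : ∀ᵐ x ∂μ, x ∈ ({a, b} : Set ℝ) := by
    rw [ae_iff]; simp [hμ]
  have hK : IsCompact ({a, b} : Set ℝ) := (Set.toFinite _).isCompact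
  -- The cubic with ψ' = 6 (x - a)(b - x), flat at both atoms: only the two off-diagonal terms
  -- contribute to the energy.
  let ψ : ℝ → ℝ := fun x => (x - a) ^ 2 * (3 * b - a - 2 * x)
  have hψ : ContDiff ℝ 1 ψ := by fun_prop
  have hder : ∀ x, deriv ψ x = 6 * (x - a) * (b - x) := by
    intro x
    refine HasDerivAt.deriv ?_
    have : HasDerivAt ψ _ x := (((hasDerivAt_id x).sub_const a).pow 2).mul
      (((hasDerivAt_id x).const_mul 2).const_sub (3 * b - a))
    exact this.congr_deriv (by simp; ring)
  have hm := h.of_contDiff hK hae hψ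
  have hint2 : Integrable (fun z : ℝ × ℝ => dslope ψ z.1 z.2 ^ 2) (μ.prod μ) :=
    integrable_dslope_sq hK hae hψ
  rw [integral_prod _ hint2, variance_eq_integral (by fun_prop)] at hm
  simp only [hint, dslope_same, hder] at hm
  rw [dslope_of_ne _ hab.ne', dslope_of_ne _ hab.ne, slope_def_field, slope_def_field] at hm
  have hba : 0 < b - a := sub_pos.2 hab
  have e1 : ψ a = 0 := by simp [ψ]
  have e2 : ψ b = (b - a) ^ 3 := by simp only [ψ]; ring
  have e3 : ((b - a) ^ 3 - 0) / (b - a) = (b - a) ^ 2 := by field_simp; ring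
  have e4 : (0 - (b - a) ^ 3) / (a - b) = (b - a) ^ 2 := by
    rw [div_eq_iff (by linarith)]; ring
  rw [e1, e2, e3, e4] at hm
  -- The energy is 2α(1 - α)(b - a)⁴ and the variance α(1 - α)(b - a)⁶; this is their common factor.
  have hw : 0 < α * (1 - α) * (b - a) ^ 4 := by
    have := sub_pos.2 h1
    positivity
  rw [le_div_iff₀ (by positivity)]
  refine le_of_mul_le_mul_right ?_ hw
  linarith

end

section

/-! ### Rescaled Chebyshev polynomials of the second kind -/

/-- The Chebyshev polynomial `U_n` transported to the interval `[a - 2 r, a + 2 r]`. -/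
noncomputable def chebU (a r : ℝ) (n : ℕ) (x : ℝ) : ℝ :=
  (Polynomial.Chebyshev.U ℝ n).eval ((x - a) / (2 * r))

section ChebU

variable {a r : ℝ}

theorem chebU_zero (x : ℝ) : chebU a r 0 x = 1 := by
  simp [chebU]

theorem chebU_one (hr : 0 < r) (x : ℝ) : chebU a r 1 x = (x - a) / r := by
  simp [chebU]
  field_simp

theorem chebU_add_two (hr : 0 < r) (n : ℕ) (x : ℝ) :
    chebU a r (n + 2) x = (x - a) / r * chebU a r (n + 1) x - chebU a r n x := by
  simp only [chebU, Nat.cast_add, Nat.cast_ofNat, Nat.cast_one,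
    Polynomial.Chebyshev.U_add_two, Polynomial.eval_sub, Polynomial.eval_mul,
    Polynomial.eval_ofNat, Polynomial.eval_X]
  field_simp

theorem contDiff_chebU (n : ℕ) : ContDiff ℝ 1 (chebU a r n) :=
  (contDiff_of_polynomial _).comp (by fun_prop)

@[fun_prop]
theorem continuous_chebU (n : ℕ) : Continuous (chebU a r n) := (contDiff_chebU n).continuous

theorem chebU_cos (hr : 0 < r) (n : ℕ) (θ : ℝ) :
    chebU a r n (a + 2 * r * Real.cos θ) * Real.sin θ = Real.sin ((n + 1) * θ) := by
  have : (a + 2 * r * Real.cos θ - a) / (2 * r) = Real.cos θ := by field_simp; ring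
  rw [chebU, this]
  simp

/-- After k = 0 and k = 1 are split off, the three-term recurrence applies to the factor in x. The
truncated `n - 1` is harmless, because the last sum is empty when n = 0. -/
theorem sum_chebU_add_two (hr : 0 < r) (n : ℕ) (x y : ℝ) :
    ∑ k ∈ Finset.range (n + 2), chebU a r k x * chebU a r (n + 1 - k) y
      = chebU a r (n + 1) y
        + (x - a) / r * ∑ k ∈ Finset.range (n + 1), chebU a r k x * chebU a r (n - k) y
        - ∑ k ∈ Finset.range n, chebU a r k x * chebU a r (n - 1 - k) y := by
  rw [Finset.sum_range_succ', Finset.sum_range_succ', Finset.sum_range_succ' _ n, chebU_zero,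
    zero_add, chebU_one hr, mul_add, Finset.mul_sum]
  have : ∀ k ∈ Finset.range n, chebU a r (k + 1 + 1) x * chebU a r (n + 1 - (k + 1 + 1)) y
      = (x - a) / r * (chebU a r (k + 1) x * chebU a r (n - (k + 1)) y)
        - chebU a r k x * chebU a r (n - 1 - k) y := by
    intro k _
    rw [chebU_add_two hr, show n + 1 - (k + 1 + 1) = n - (k + 1) by omega,
      show n - 1 - k = n - (k + 1) by omega]
    ring
  rw [Finset.sum_congr rfl this, Finset.sum_sub_distrib]
  simp only [tsub_zero, Nat.add_sub_cancel]
  ring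

/-- Both sides obey the same second-order recurrence in n. This is the coproduct-like formula for D
U_n on which both directions of the semicircular case rest. -/
theorem chebU_sub (hr : 0 < r) (n : ℕ) (x y : ℝ) :
    chebU a r n y - chebU a r n x = (y - x) * (1 / r *
      ∑ k ∈ Finset.range n, chebU a r k x * chebU a r (n - 1 - k) y) := by
  induction n using Nat.twoStepInduction with
  | zero => simp [chebU_zero]
  | one => simp [chebU_one hr, chebU_zero]; field_simp; ring
  | more n ih0 ih1 =>
    rw [Nat.add_sub_cancel] at ih1
    rw [show n + 2 - 1 = n + 1 by omega, sum_chebU_add_two hr, chebU_add_two hr, chebU_add_two hr]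
    have e : (y - a) / r * chebU a r (n + 1) y - chebU a r n y
        - ((x - a) / r * chebU a r (n + 1) x - chebU a r n x)
        = (x - a) / r * (chebU a r (n + 1) y - chebU a r (n + 1) x)
          + (y - x) / r * chebU a r (n + 1) y - (chebU a r n y - chebU a r n x) := by ring
    rw [e, ih0, ih1]
    ring

theorem dslope_chebU (hr : 0 < r) (n : ℕ) (x y : ℝ) :
    dslope (chebU a r n) x y
      = 1 / r * ∑ k ∈ Finset.range n, chebU a r k x * chebU a r (n - 1 - k) y :=
  dslope_eq_of_factor (S := fun y => 1 / r *
    ∑ k ∈ Finset.range n, chebU a r k x * chebU a r (n - 1 - k) y)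
    (Continuous.continuousAt (by fun_prop)) (chebU_sub hr n x) y

/-- Every polynomial function is a finite linear combination of the `chebU a r n`. -/
theorem exists_eval_eq_sum_chebU (a : ℝ) (hr : 0 < r) (q : Polynomial ℝ) :
    ∃ (N : ℕ) (c : ℕ → ℝ), (∀ n, N < n → c n = 0) ∧
      ∀ x, q.eval x = ∑ n ∈ Finset.range (N + 1), c n * chebU a r n x := by
  set S := Submodule.span ℝ (Set.range (chebU a r)) with hS
  have hmem : ∀ n, chebU a r n ∈ S := fun n => Submodule.subset_span ⟨n, rfl⟩
  -- The recurrence makes the span stable under multiplication by x; as it contains the constants,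
  -- it contains every polynomial.
  have hX : ∀ f ∈ S, (fun x => x * f x) ∈ S := by
    intro f hf
    induction hf using Submodule.span_induction with
    | mem f hf =>
      obtain ⟨n, rfl⟩ := hf
      rcases n with _ | n
      · have : (fun x => x * chebU a r 0 x) = r • chebU a r 1 + a • chebU a r 0 := by
          funext x
          simp [chebU_zero, chebU_one hr]
          field_simp
          ring
        rw [this]
        exact S.add_mem (S.smul_mem _ (hmem _)) (S.smul_mem _ (hmem _))
      · have : (fun x => x * chebU a r (n + 1) x)
            = r • (chebU a r (n + 2) + chebU a r n) + a • chebU a r (n + 1) := by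
          funext x
          simp only [Pi.add_apply, Pi.smul_apply, smul_eq_mul, chebU_add_two hr]
          field_simp
          ring
        rw [this]
        exact S.add_mem (S.smul_mem _ (S.add_mem (hmem _) (hmem _))) (S.smul_mem _ (hmem _))
    | zero =>
      simp only [Pi.zero_apply, mul_zero]
      exact S.zero_mem
    | add f g _ _ hf hg =>
      have : (fun x => x * (f + g) x) = (fun x => x * f x) + fun x => x * g x := by
        funext x; simp [mul_add]
      rw [this]
      exact S.add_mem hf hg
    | smul c f _ hf =>
      have : (fun x => x * (c • f) x) = c • fun x => x * f x := by
        funext x; simp; ring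
      rw [this]
      exact S.smul_mem _ hf
  have hq : (fun x => q.eval x) ∈ S := by
    induction q using Polynomial.induction_on with
    | C c =>
      have : (fun x => (Polynomial.C c).eval x) = c • chebU a r 0 := by
        funext x; simp [chebU_zero]
      rw [this]
      exact S.smul_mem _ (hmem _)
    | add p q hp hq => simpa [Polynomial.eval_add] using! S.add_mem hp hq
    | monomial n c h =>
      have := hX _ h
      convert this using 2 with x
      simp
      ring
  obtain ⟨c, hc⟩ := Finsupp.mem_span_range_iff_exists_finsupp.1 hq
  refine ⟨c.support.sup id, c, fun n hn => ?_, fun x => ?_⟩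
  · by_contra h
    exact absurd (Finset.le_sup (f := id) (Finsupp.mem_support_iff.2 h)) (not_le.2 hn)
  · have h1 := congrFun hc x
    rw [Finsupp.sum_of_support_subset (s := Finset.range (c.support.sup id + 1)) c
      (fun n hn => Finset.mem_range.2 (Nat.lt_succ_of_le (Finset.le_sup (f := id) hn))) _
      (by simp)] at h1
    simpa using h1.symm

end ChebU

/-! ### The semicircular law -/

/-- Substitute x = a + 2r cos θ: the density and the Jacobian each contribute a factor 2r sin θ. -/
theorem integral_semicircular {a r : ℝ} (hr : 0 < r) {f : ℝ → ℝ} (hf : Continuous f) :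
    ∫ x, f x ∂(semicircular a r)
      = 2 / Real.pi * ∫ θ in (0 : ℝ)..Real.pi, f (a + 2 * r * Real.cos θ) * Real.sin θ ^ 2 := by
  have hpi := Real.pi_pos
  set w : ℝ → ℝ := fun x => 1 / (2 * Real.pi * r ^ 2) * Real.sqrt (4 * r ^ 2 - (x - a) ^ 2) with hw
  have hwc : Continuous w := by fun_prop
  have hw0 : ∀ x, 0 ≤ (Set.Icc (a - 2 * r) (a + 2 * r)).indicator w x := fun x =>
    Set.indicator_nonneg (fun x _ => by positivity) x
  rw [semicircular, integral_withDensity_eq_integral_toReal_smul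
    ((hwc.measurable.indicator measurableSet_Icc).ennreal_ofReal) (by simp)]
  simp_rw [ENNReal.toReal_ofReal (hw0 _)]
  have e1 : ∀ x, (Set.Icc (a - 2 * r) (a + 2 * r)).indicator w x • f x
      = (Set.Icc (a - 2 * r) (a + 2 * r)).indicator (fun x => w x * f x) x := by
    intro x
    simp [Set.indicator]
  simp_rw [e1]
  rw [integral_indicator measurableSet_Icc, integral_Icc_eq_integral_Ioc,
    ← intervalIntegral.integral_of_le (by linarith)]
  have hsub := intervalIntegral.integral_comp_mul_deriv (a := 0) (b := Real.pi)
    (f := fun θ => a + 2 * r * Real.cos θ) (f' := fun θ => 2 * r * (-Real.sin θ))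
    (g := fun x => w x * f x)
    (fun θ _ => ((Real.hasDerivAt_cos θ).const_mul (2 * r)).const_add a)
    (by fun_prop) (by fun_prop)
  simp only [Real.cos_zero, Real.cos_pi, mul_one, mul_neg, Function.comp_def] at hsub
  rw [intervalIntegral.integral_symm, sub_eq_add_neg, ← hsub, ← intervalIntegral.integral_neg,
    ← intervalIntegral.integral_const_mul]
  refine intervalIntegral.integral_congr fun θ hθ => ?_
  rw [Set.uIcc_of_le hpi.le] at hθ
  have hs := Real.sin_nonneg_of_mem_Icc hθ
  have e2 : 4 * r ^ 2 - (a + 2 * r * Real.cos θ - a) ^ 2 = (2 * r * Real.sin θ) ^ 2 := by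
    have := Real.sin_sq_add_cos_sq θ
    linear_combination (-4 * r ^ 2) * this
  simp only [hw, e2, Real.sqrt_sq (by positivity : 0 ≤ 2 * r * Real.sin θ)]
  field_simp

theorem integral_cos_int_mul {k : ℤ} (hk : k ≠ 0) :
    ∫ θ in (0 : ℝ)..Real.pi, Real.cos (k * θ) = 0 := by
  have : (k : ℝ) ≠ 0 := Int.cast_ne_zero.2 hk
  rw [intervalIntegral.integral_comp_mul_left (fun x => Real.cos x) this]
  simp [Real.sin_int_mul_pi]

/-- In the angle θ this is the orthogonality of sin((m+1)θ) and sin((n+1)θ) on [0, π]. -/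
theorem integral_chebU_mul_chebU {a r : ℝ} (hr : 0 < r) (m n : ℕ) :
    ∫ x, chebU a r m x * chebU a r n x ∂(semicircular a r) = if m = n then 1 else 0 := by
  rw [integral_semicircular hr (by fun_prop)]
  have e : ∀ θ : ℝ, chebU a r m (a + 2 * r * Real.cos θ) * chebU a r n (a + 2 * r * Real.cos θ)
      * Real.sin θ ^ 2 = (1 / 2) * (Real.cos (((m - n : ℤ) : ℝ) * θ)
        - Real.cos (((m + n + 2 : ℤ) : ℝ) * θ)) := by
    intro θ
    rw [show chebU a r m (a + 2 * r * Real.cos θ) * chebU a r n (a + 2 * r * Real.cos θ)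
      * Real.sin θ ^ 2 = (chebU a r m (a + 2 * r * Real.cos θ) * Real.sin θ)
        * (chebU a r n (a + 2 * r * Real.cos θ) * Real.sin θ) by ring, chebU_cos hr, chebU_cos hr]
    rw [show (((m - n : ℤ) : ℝ) * θ) = (m + 1) * θ - (n + 1) * θ by push_cast; ring,
      show (((m + n + 2 : ℤ) : ℝ) * θ) = (m + 1) * θ + (n + 1) * θ by push_cast; ring,
      Real.cos_sub, Real.cos_add]
    ring
  simp_rw [e]
  rw [intervalIntegral.integral_const_mul, intervalIntegral.integral_sub
    (Continuous.intervalIntegrable (by fun_prop) _ _)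
    (Continuous.intervalIntegrable (by fun_prop) _ _),
    integral_cos_int_mul (k := m + n + 2) (by omega)]
  have := Real.pi_pos.ne'
  split_ifs with h
  · subst h
    simp
    field_simp
  · rw [integral_cos_int_mul (by omega)]
    simp

theorem isProbabilityMeasure_semicircular (a : ℝ) {r : ℝ} (hr : 0 < r) :
    IsProbabilityMeasure (semicircular a r) := by
  have hfin : IsFiniteMeasure (semicircular a r) := by
    refine isFiniteMeasure_withDensity_ofReal (Integrable.hasFiniteIntegral ?_)
    exact (integrable_indicator_iff measurableSet_Icc).2
      (Continuous.integrableOn_Icc (by fun_prop))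
  have h1 := integral_chebU_mul_chebU (a := a) hr 0 0
  simp only [chebU_zero, mul_one, integral_const, smul_eq_mul, if_true] at h1
  exact ⟨by rw [← ENNReal.toReal_eq_one_iff]; exact h1⟩

theorem ae_mem_semicircular (a r : ℝ) :
    ∀ᵐ x ∂(semicircular a r), x ∈ Set.Icc (a - 2 * r) (a + 2 * r) := by
  rw [semicircular, ae_withDensity_iff (Measurable.ennreal_ofReal
    (Measurable.indicator (by fun_prop) measurableSet_Icc))]
  refine .of_forall fun x hx => ?_
  by_contra h
  simp [Set.indicator_of_notMem h] at hx

/-! ### The Poincaré inequality of the semicircular law -/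

theorem integral_sq_sum_of_orthonormal {X ι : Type*} [DecidableEq ι] [MeasurableSpace X]
    {μ : Measure X} (s : Finset ι) (e : ι → X → ℝ) (c : ι → ℝ)
    (hint : ∀ i ∈ s, ∀ j ∈ s, Integrable (fun x => e i x * e j x) μ)
    (horth : ∀ i ∈ s, ∀ j ∈ s, ∫ x, e i x * e j x ∂μ = if i = j then 1 else 0) :
    ∫ x, (∑ i ∈ s, c i * e i x) ^ 2 ∂μ = ∑ i ∈ s, c i ^ 2 := by
  have h : ∀ x, (∑ i ∈ s, c i * e i x) ^ 2
      = ∑ i ∈ s, ∑ j ∈ s, c i * c j * (e i x * e j x) := by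
    intro x
    rw [sq, Finset.sum_mul_sum]
    exact Finset.sum_congr rfl fun i _ => Finset.sum_congr rfl fun j _ => by ring
  simp_rw [h]
  rw [integral_finsetSum _ fun i hi => integrable_finsetSum _ fun j hj =>
    (hint i hi j hj).const_mul _]
  refine Finset.sum_congr rfl fun i hi => ?_
  rw [integral_finsetSum _ fun j hj => (hint i hi j hj).const_mul _]
  have : ∀ j ∈ s, ∫ x, c i * c j * (e i x * e j x) ∂μ = if i = j then c i * c j else 0 := by
    intro j hj
    rw [integral_const_mul, horth i hi j hj]
    simp
  rw [Finset.sum_congr rfl this]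
  simp [hi, sq]

/-- Reindexing by n = k + l + 1 reveals a Hankel matrix. The triangle k + l < N can be completed to
a square because c vanishes beyond N. -/
theorem sum_mul_sum_range_eq (N : ℕ) (c : ℕ → ℝ) (hc : ∀ n, N < n → c n = 0) (f : ℕ → ℕ → ℝ) :
    ∑ n ∈ Finset.range (N + 1), c n * ∑ k ∈ Finset.range n, f k (n - 1 - k)
      = ∑ z ∈ Finset.range N ×ˢ Finset.range N, c (z.1 + z.2 + 1) * f z.1 z.2 := by
  rw [Finset.sum_range_succ', Finset.sum_product]
  have h1 : ∀ m ∈ Finset.range N, c (m + 1) * ∑ k ∈ Finset.range (m + 1), f k (m + 1 - 1 - k)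
      = ∑ k ∈ Finset.range (m + 1), (fun k l => c (k + l + 1) * f k l) k (m - k) := by
    intro m _
    rw [Finset.mul_sum]
    refine Finset.sum_congr rfl fun k hk => ?_
    rw [Finset.mem_range] at hk
    simp only [Nat.add_sub_cancel, show k + (m - k) = m by omega]
  rw [Finset.sum_congr rfl h1, Finset.sum_range_diag_flip N fun k l => c (k + l + 1) * f k l]
  simp only [Finset.range_zero, Finset.sum_empty, mul_zero, add_zero]
  refine Finset.sum_congr rfl fun k hk => ?_
  refine Finset.sum_subset (Finset.range_mono (Nat.sub_le _ _)) fun l _ hl => ?_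
  rw [Finset.mem_range] at hl
  rw [hc _ (by omega), zero_mul]

/-- By orthonormality the variance is the sum of c_{k+1}² and the energy is r⁻² times the sum of all
c_{k+l+1}². Dropping every term except l = 0 gives the inequality. -/
theorem semicircular_poincare_polynomial (a : ℝ) {r : ℝ} (hr : 0 < r) (q : Polynomial ℝ) :
    1 / r ^ 2 * variance (fun x => q.eval x) (semicircular a r) ≤
      ∫ z : ℝ × ℝ, (dslope (fun x => q.eval x) z.1 z.2) ^ 2
        ∂((semicircular a r).prod (semicircular a r)) := by
  have := isProbabilityMeasure_semicircular a hr
  set μ := semicircular a r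
  have hK : IsCompact (Set.Icc (a - 2 * r) (a + 2 * r)) := isCompact_Icc
  have hμ : ∀ᵐ x ∂μ, x ∈ Set.Icc (a - 2 * r) (a + 2 * r) := ae_mem_semicircular a r
  have hint : ∀ m n, Integrable (fun x => chebU a r m x * chebU a r n x) μ := fun m n =>
    integrable_of_continuous_of_ae_mem hK hμ (by fun_prop)
  obtain ⟨N, c, hc, hq⟩ := exists_eval_eq_sum_chebU a hr q
  have hvar : variance (fun x => q.eval x) μ = ∑ n ∈ Finset.range N, c (n + 1) ^ 2 := by
    rw [variance_eq_sub (memLp_of_continuous_of_ae_mem hK hμ q.continuous)]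
    simp only [Pi.pow_apply, hq]
    rw [integral_sq_sum_of_orthonormal _ _ _ (fun i _ j _ => hint i j)
      (fun i _ j _ => integral_chebU_mul_chebU hr i j), integral_finsetSum _ fun i _ =>
        (integrable_of_continuous_of_ae_mem hK hμ (by fun_prop)), Finset.sum_range_succ']
    have : ∀ i ∈ Finset.range (N + 1), ∫ x, c i * chebU a r i x ∂μ = if i = 0 then c i else 0 := by
      intro i _
      have := integral_chebU_mul_chebU (a := a) hr i 0
      simp only [chebU_zero, mul_one] at this
      rw [integral_const_mul, this]
      simp
    rw [Finset.sum_congr rfl this]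
    simp
  have hD : ∀ z : ℝ × ℝ, dslope (fun x => q.eval x) z.1 z.2
      = ∑ i ∈ Finset.range N ×ˢ Finset.range N,
        (1 / r * c (i.1 + i.2 + 1)) * (chebU a r i.1 z.1 * chebU a r i.2 z.2) := by
    intro z
    have h1 := dslope_eq_of_factor (φ := fun x => q.eval x) (x := z.1)
      (S := fun y => 1 / r * ∑ n ∈ Finset.range (N + 1), c n *
        ∑ k ∈ Finset.range n, chebU a r k z.1 * chebU a r (n - 1 - k) y)
      (Continuous.continuousAt (by fun_prop)) (fun y => by
        simp only [hq]
        rw [← Finset.sum_sub_distrib, Finset.mul_sum, Finset.mul_sum]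
        refine Finset.sum_congr rfl fun n _ => ?_
        rw [← mul_sub, chebU_sub hr]
        ring) z.2
    rw [h1, sum_mul_sum_range_eq N c hc fun k l => chebU a r k z.1 * chebU a r l z.2,
      Finset.mul_sum]
    exact Finset.sum_congr rfl fun i _ => by ring
  have horth : ∀ i j : ℕ × ℕ, ∫ z : ℝ × ℝ, (chebU a r i.1 z.1 * chebU a r i.2 z.2) *
      (chebU a r j.1 z.1 * chebU a r j.2 z.2) ∂(μ.prod μ) = if i = j then 1 else 0 := by
    intro i j
    have e : ∀ z : ℝ × ℝ, (chebU a r i.1 z.1 * chebU a r i.2 z.2) *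
      (chebU a r j.1 z.1 * chebU a r j.2 z.2) = (chebU a r i.1 z.1 * chebU a r j.1 z.1) *
        (chebU a r i.2 z.2 * chebU a r j.2 z.2) := fun z => by ring
    simp_rw [e]
    rw [integral_prod_mul (fun x => chebU a r i.1 x * chebU a r j.1 x)
      (fun x => chebU a r i.2 x * chebU a r j.2 x), integral_chebU_mul_chebU hr,
      integral_chebU_mul_chebU hr]
    simp only [Prod.ext_iff]
    split_ifs <;> simp_all
  simp_rw [hD]
  rw [integral_sq_sum_of_orthonormal (Finset.range N ×ˢ Finset.range N)
    (fun i z => chebU a r i.1 z.1 * chebU a r i.2 z.2) _ (fun i _ j _ =>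
      integrable_of_continuous_of_ae_mem (hK.prod hK) (ae_prod_mem hμ hμ) (by fun_prop))
    (fun i _ j _ => horth i j), hvar, Finset.sum_product, Finset.mul_sum]
  refine Finset.sum_le_sum fun k hk => ?_
  have h0 : 0 < N := (Nat.zero_le _).trans_lt (Finset.mem_range.1 hk)
  refine le_trans (le_of_eq ?_) (Finset.single_le_sum (f := fun l => (1 / r * c (k + l + 1)) ^ 2)
    (fun l _ => sq_nonneg _) (Finset.mem_range.2 h0))
  simp only [add_zero]
  ring

end

/-! ### Reduction to polynomials by density -/

section

variable {μ ν : Measure ℝ} {K : Set ℝ}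

theorem exists_polynomial_derivative_eq (p : Polynomial ℝ) :
    ∃ q : Polynomial ℝ, Polynomial.derivative q = p := by
  induction p using Polynomial.induction_on' with
  | add p q hp hq =>
    obtain ⟨p', rfl⟩ := hp
    obtain ⟨q', rfl⟩ := hq
    exact ⟨p' + q', by simp⟩
  | monomial n c =>
    refine ⟨Polynomial.monomial (n + 1) (c / (n + 1)), ?_⟩
    rw [Polynomial.derivative_monomial]
    have : ((n : ℝ) + 1) ≠ 0 := by positivity
    simp
    field_simp

/-- `C¹` functions are approximated by polynomials, uniformly for the difference quotients. -/
theorem exists_polynomial_dslope_near {ψ : ℝ → ℝ} (hψ : ContDiff ℝ 1 ψ) (α β : ℝ) {ε : ℝ}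
    (hε : 0 < ε) : ∃ q : Polynomial ℝ, ∀ x ∈ Set.Icc α β, ∀ y ∈ Set.Icc α β,
      |dslope (fun x => q.eval x) x y - dslope ψ x y| ≤ ε := by
  have hd : Continuous (deriv ψ) := hψ.continuous_deriv le_rfl
  -- Approximate ψ' by p and take a primitive q: the difference of the two quotients is an average
  -- of q' - ψ' over a segment.
  obtain ⟨p, hp⟩ := exists_polynomial_near_of_continuousOn α β _ hd.continuousOn ε hε
  obtain ⟨q, rfl⟩ := exists_polynomial_derivative_eq p
  refine ⟨q, fun x hx y hy => ?_⟩
  rw [dslope_eq_integral (contDiff_of_polynomial q), dslope_eq_integral hψ]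
  simp only [Polynomial.deriv]
  rw [← intervalIntegral.integral_sub (Continuous.intervalIntegrable (by fun_prop) _ _)
    (Continuous.intervalIntegrable (by fun_prop) _ _)]
  have := intervalIntegral.norm_integral_le_of_norm_le_const (a := 0) (b := 1) (C := ε)
    (f := fun t => (Polynomial.derivative q).eval (x + t * (y - x)) - deriv ψ (x + t * (y - x)))
    fun t ht => by
      rw [Set.uIoc_of_le zero_le_one] at ht
      refine (hp _ ?_).le
      have hmem := (convex_Icc α β) hx hy (sub_nonneg.2 ht.2) ht.1.le (by ring)
      convert hmem using 1
      simp only [smul_eq_mul]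
      ring
  simpa using this

theorem variance_eq_dslope [IsProbabilityMeasure μ] (hK : IsCompact K) (hμ : ∀ᵐ x ∂μ, x ∈ K)
    {φ : ℝ → ℝ} (hφ : Continuous φ) :
    2 * variance φ μ = ∫ z : ℝ × ℝ, (z.2 - z.1) ^ 2 * dslope φ z.1 z.2 ^ 2 ∂(μ.prod μ) := by
  rw [variance_eq_double_integral hK hμ hφ]
  simp_rw [← mul_pow, sub_mul_dslope]

/-- On a compactly supported measure it suffices to test the Poincaré inequality on polynomials. -/
theorem poincareInequality_of_polynomial [IsProbabilityMeasure μ] {α β C : ℝ}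
    (hμ : ∀ᵐ x ∂μ, x ∈ Set.Icc α β)
    (h : ∀ q : Polynomial ℝ, C * variance (fun x => q.eval x) μ ≤
      ∫ z : ℝ × ℝ, (dslope (fun x => q.eval x) z.1 z.2) ^ 2 ∂(μ.prod μ)) :
    PoincareInequality μ C := by
  intro ψ hψ _
  have hK : IsCompact (Set.Icc α β) := isCompact_Icc
  choose q hq using fun n : ℕ =>
    exists_polynomial_dslope_near hψ α β (Nat.one_div_pos_of_nat (α := ℝ) (n := n))
  have hae := ae_prod_mem hμ hμ
  have hψc := continuous_dslope hψ
  have hqc : ∀ n, Continuous fun z : ℝ × ℝ => dslope (fun x => (q n).eval x) z.1 z.2 := fun n =>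
    continuous_dslope (contDiff_of_polynomial (q n))
  -- The weight w = 1 gives the energy and w = (y - x)² gives twice the variance, so one limit
  -- serves both sides.
  have key : ∀ w : ℝ × ℝ → ℝ, Continuous w → Filter.Tendsto
      (fun n => ∫ z : ℝ × ℝ, w z * dslope (fun x => (q n).eval x) z.1 z.2 ^ 2 ∂(μ.prod μ))
      Filter.atTop (nhds (∫ z : ℝ × ℝ, w z * dslope ψ z.1 z.2 ^ 2 ∂(μ.prod μ))) := by
    intro w hw
    refine tendsto_integral_of_dominated_convergence
      (fun z => |w z| * (|dslope ψ z.1 z.2| + 1) ^ 2)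
      (fun n => (hw.mul ((hqc n).pow 2)).aestronglyMeasurable)
      (integrable_of_continuous_of_ae_mem (hK.prod hK) hae (by fun_prop)) ?_ ?_
    · intro n
      filter_upwards [hae] with z hz
      have h1 := hq n z.1 hz.1 z.2 hz.2
      have h2 : (1 : ℝ) / (n + 1) ≤ 1 := by
        rw [div_le_one (by positivity)]
        linarith [(Nat.cast_nonneg n : (0 : ℝ) ≤ n)]
      have h3 : |dslope (fun x => (q n).eval x) z.1 z.2| ≤ |dslope ψ z.1 z.2| + 1 := by
        have := abs_sub_abs_le_abs_sub (dslope (fun x => (q n).eval x) z.1 z.2) (dslope ψ z.1 z.2)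
        linarith
      rw [norm_mul, Real.norm_eq_abs, Real.norm_eq_abs, abs_pow]
      gcongr
    · filter_upwards [hae] with z hz
      refine ((tendsto_iff_norm_sub_tendsto_zero.2 ?_).pow 2).const_mul (w z)
      exact squeeze_zero (fun n => norm_nonneg _) (fun n => hq n z.1 hz.1 z.2 hz.2)
        tendsto_one_div_add_atTop_nhds_zero_nat
  have k1 := key (fun _ => 1) continuous_const
  have k2 := (key (fun z => (z.2 - z.1) ^ 2) (by fun_prop)).const_mul (C / 2)
  simp only [one_mul] at k1
  have e : ∀ f : ℝ → ℝ, Continuous f → C / 2 * ∫ z : ℝ × ℝ, (z.2 - z.1) ^ 2 *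
      dslope f z.1 z.2 ^ 2 ∂(μ.prod μ) = C * variance f μ := fun f hf => by
    rw [← variance_eq_dslope hK hμ hf]; ring
  simp_rw [fun n => e (fun x => (q n).eval x) (q n).continuous] at k2
  rw [e ψ hψ.continuous] at k2
  exact le_of_tendsto_of_tendsto' k2 k1 fun n => h (q n)

theorem poincareInequality_semicircular (a : ℝ) {r : ℝ} (hr : 0 < r) :
    PoincareInequality (semicircular a r) (1 / r ^ 2) :=
  have := isProbabilityMeasure_semicircular a hr
  poincareInequality_of_polynomial (ae_mem_semicircular a r)
    (semicircular_poincare_polynomial a hr)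

theorem variance_semicircular (a : ℝ) {r : ℝ} (hr : 0 < r) :
    variance (fun x : ℝ => x) (semicircular a r) = r ^ 2 := by
  have := isProbabilityMeasure_semicircular a hr
  have e : (fun x : ℝ => x) = fun x => r * chebU a r 1 x + a := by
    funext x
    rw [chebU_one hr]
    field_simp
    ring
  have hc : Continuous fun x => r * chebU a r 1 x := by fun_prop
  have h0 := integral_chebU_mul_chebU (a := a) hr 1 0
  have h1 := integral_chebU_mul_chebU (a := a) hr 1 1
  simp only [chebU_zero, mul_one, one_ne_zero, if_false, if_true] at h0 h1
  rw [e, variance_add_const hc.aestronglyMeasurable, variance_const_mul,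
    variance_of_integral_eq_zero (Continuous.aemeasurable (by fun_prop)) h0]
  simp_rw [sq (chebU a r 1 _)]
  rw [h1, mul_one]

/-! ### Rigidity in the upper bound -/

/-- Compactly supported measures with the same polynomial integrals agree. -/
theorem ext_of_integral_polynomial [IsProbabilityMeasure μ] [IsProbabilityMeasure ν] {α β : ℝ}
    (hμ : ∀ᵐ x ∂μ, x ∈ Set.Icc α β) (hν : ∀ᵐ x ∂ν, x ∈ Set.Icc α β)
    (h : ∀ q : Polynomial ℝ, ∫ x, q.eval x ∂μ = ∫ x, q.eval x ∂ν) : μ = ν := by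
  refine ext_of_forall_integral_eq_of_IsFiniteMeasure fun f => ?_
  have near : ∀ ε > 0, ∃ q : Polynomial ℝ, ∀ κ : Measure ℝ, IsProbabilityMeasure κ →
      (∀ᵐ x ∂κ, x ∈ Set.Icc α β) → |∫ x, q.eval x ∂κ - ∫ x, f x ∂κ| ≤ ε := by
    intro ε hε
    obtain ⟨q, hq⟩ := exists_polynomial_near_of_continuousOn α β f f.continuous.continuousOn ε hε
    refine ⟨q, fun κ _ hκ => ?_⟩
    rw [← integral_sub (integrable_of_continuous_of_ae_mem isCompact_Icc hκ q.continuous)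
      (integrable_of_continuous_of_ae_mem isCompact_Icc hκ f.continuous)]
    have := norm_integral_le_of_norm_le_const (μ := κ) (C := ε)
      (f := fun x => q.eval x - f x) (by filter_upwards [hκ] with x hx using (hq x hx).le)
    simpa using this
  by_contra hne
  have hpos : 0 < |∫ x, f x ∂μ - ∫ x, f x ∂ν| := abs_pos.2 (sub_ne_zero.2 hne)
  obtain ⟨q, hq⟩ := near (|∫ x, f x ∂μ - ∫ x, f x ∂ν| / 3) (by positivity)
  have h1 := hq μ inferInstance hμ
  have h2 := hq ν inferInstance hν
  rw [h q] at h1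
  have h3 := abs_sub_le (∫ x, f x ∂μ) (∫ x, q.eval x ∂ν) (∫ x, f x ∂ν)
  rw [abs_sub_comm (∫ x, f x ∂μ) (∫ x, q.eval x ∂ν)] at h3
  linarith

/-- The Euler–Lagrange equation of the Poincaré inequality at the extremal function `x ↦ x`. -/
theorem integral_dslope_eq_covariance [IsProbabilityMeasure μ] (hK : IsCompact K)
    (hμ : ∀ᵐ x ∂μ, x ∈ K) (hv : 0 < variance (fun x : ℝ => x) μ)
    (hP : PoincareInequality μ (1 / variance (fun x : ℝ => x) μ)) {ψ : ℝ → ℝ}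
    (hψ : ContDiff ℝ 1 ψ) :
    ∫ z : ℝ × ℝ, dslope ψ z.1 z.2 ∂(μ.prod μ)
      = cov[fun x : ℝ => x, ψ; μ] / variance (fun x : ℝ => x) μ := by
  set v := variance (fun x : ℝ => x) μ with hv_def
  set D := ∫ z : ℝ × ℝ, dslope ψ z.1 z.2 ∂(μ.prod μ)
  set D2 := ∫ z : ℝ × ℝ, dslope ψ z.1 z.2 ^ 2 ∂(μ.prod μ)
  have hDc := continuous_dslope hψ
  have hψL : MemLp ψ 2 μ := memLp_of_continuous_of_ae_mem hK hμ hψ.continuous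
  have hxL : MemLp (fun x : ℝ => x) 2 μ := memLp_of_continuous_of_ae_mem hK hμ continuous_id
  -- The function x saturates the inequality, so perturbing it by tψ leaves a nonnegative quadratic
  -- without constant term; its linear coefficient must vanish.
  have key : ∀ t : ℝ, 0 ≤ (D2 - variance ψ μ / v) * (t * t)
      + 2 * (D - cov[fun x : ℝ => x, ψ; μ] / v) * t + 0 := by
    intro t
    have h1 := hP.of_contDiff hK hμ (ψ := fun x => x + t * ψ x) (by fun_prop)
    have h2 : ∀ z : ℝ × ℝ, dslope (fun x => x + t * ψ x) z.1 z.2 = 1 + t * dslope ψ z.1 z.2 :=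
      fun z => dslope_eq_of_factor (S := fun y => 1 + t * dslope ψ z.1 y)
        (Continuous.continuousAt (by have : Continuous (dslope ψ z.1) :=
                                        hDc.comp (by fun_prop : Continuous fun y => (z.1, y))
                                     fun_prop))
        (fun y => by linear_combination -t * sub_mul_dslope ψ z.1 y) z.2
    have h3 : ∀ z : ℝ × ℝ, (1 + t * dslope ψ z.1 z.2) ^ 2
        = 1 + (2 * t * dslope ψ z.1 z.2 + t ^ 2 * dslope ψ z.1 z.2 ^ 2) := fun z => by ring
    have i1 : Integrable (fun z : ℝ × ℝ => 2 * t * dslope ψ z.1 z.2) (μ.prod μ) :=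
      integrable_of_continuous_of_ae_mem (hK.prod hK) (ae_prod_mem hμ hμ) (by fun_prop)
    have i2 : Integrable (fun z : ℝ × ℝ => t ^ 2 * dslope ψ z.1 z.2 ^ 2) (μ.prod μ) :=
      integrable_of_continuous_of_ae_mem (hK.prod hK) (ae_prod_mem hμ hμ) (by fun_prop)
    simp_rw [h2, h3] at h1
    have i12 : Integrable (fun z : ℝ × ℝ =>
      2 * t * dslope ψ z.1 z.2 + t ^ 2 * dslope ψ z.1 z.2 ^ 2) (μ.prod μ) := i1.add i2
    rw [integral_add (integrable_const _) i12, integral_add i1 i2, integral_const_mul,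
      integral_const_mul, variance_fun_add hxL (hψL.const_mul t), covariance_const_mul_right,
      variance_const_mul] at h1
    simp only [integral_const, probReal_univ, smul_eq_mul, mul_one] at h1
    rw [← hv_def] at h1
    have e : 1 / v * (v + 2 * (t * cov[fun x : ℝ => x, ψ; μ]) + t ^ 2 * variance ψ μ)
        = 1 + 2 * t * (cov[fun x : ℝ => x, ψ; μ] / v) + t ^ 2 * (variance ψ μ / v) := by
      field_simp
    rw [e] at h1
    change _ ≤ 1 + (2 * t * D + t ^ 2 * D2) at h1
    linarith
  have := discrim_le_zero key
  rw [discrim, mul_zero, sub_zero] at this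
  have := pow_eq_zero_iff (two_ne_zero) |>.1 (le_antisymm this (sq_nonneg _))
  linarith

theorem isSemicircular_of_poincareInequality [IsProbabilityMeasure μ] (hK : IsCompact K)
    (hμ : ∀ᵐ x ∂μ, x ∈ K) (hv : 0 < variance (fun x : ℝ => x) μ)
    (hP : PoincareInequality μ (1 / variance (fun x : ℝ => x) μ)) : IsSemicircular μ := by
  set v := variance (fun x : ℝ => x) μ with hv_def
  set a := ∫ x, x ∂μ with ha
  set r := √v with hr_def
  have hr : 0 < r := Real.sqrt_pos.2 hv
  have hrv : r ^ 2 = v := Real.sq_sqrt hv.le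
  have hint : ∀ {f : ℝ → ℝ}, Continuous f → Integrable f μ := fun hf =>
    integrable_of_continuous_of_ae_mem hK hμ hf
  set m : ℕ → ℝ := fun n => ∫ x, chebU a r n x ∂μ with hm
  have m0 : m 0 = 1 := by simp [hm, chebU_zero]
  have m1 : m 1 = 0 := by
    simp only [hm, chebU_one hr]
    rw [integral_div, integral_sub (hint continuous_id') (integrable_const _)]
    simp [← ha]
  -- The first variation at U_{n+1}: its left side factors by the formula for D U_{n+1}, and x
  -- U_{n+1} = a U_{n+1} + r (U_{n+2} + U_n) computes the covariance.
  have hrec : ∀ n, m (n + 2) + m n = ∑ k ∈ Finset.range (n + 1), m k * m (n - k) := by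
    intro n
    have h1 := integral_dslope_eq_covariance hK hμ hv hP (contDiff_chebU (a := a) (r := r) (n + 1))
    simp_rw [dslope_chebU hr, Nat.add_sub_cancel] at h1
    rw [integral_const_mul, integral_finsetSum _ fun k _ => integrable_of_continuous_of_ae_mem
      (hK.prod hK) (ae_prod_mem hμ hμ) (by fun_prop)] at h1
    simp_rw [integral_prod_mul] at h1
    rw [covariance_eq_sub (memLp_of_continuous_of_ae_mem hK hμ continuous_id')
      (memLp_of_continuous_of_ae_mem hK hμ (by fun_prop)), ← ha, ← hv_def] at h1
    have e : ∀ x, ((fun x : ℝ => x) * chebU a r (n + 1)) x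
        = a * chebU a r (n + 1) x + r * (chebU a r (n + 2) x + chebU a r n x) := by
      intro x
      rw [chebU_add_two hr, Pi.mul_apply]
      field_simp
      ring
    simp_rw [e] at h1
    rw [integral_add (hint (by fun_prop)) (hint (by fun_prop)), integral_const_mul,
      integral_const_mul, integral_add (hint (by fun_prop)) (hint (by fun_prop)),
      add_sub_cancel_left, ← hrv] at h1
    change 1 / r * ∑ k ∈ Finset.range (n + 1), m k * m (n - k) = r * (m (n + 2) + m n) / r ^ 2 at h1
    field_simp at h1
    exact h1.symm
  have hzero : ∀ n, m (n + 1) = 0 := by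
    intro n
    induction n using Nat.strong_induction_on with
    | _ n ih =>
      rcases n with _ | n
      · exact m1
      -- By induction only the k = 0 term survives, and it cancels the `m n` on the left of the
      -- recursion.
      · have hs : ∑ k ∈ Finset.range (n + 1), m k * m (n - k) = m n := by
          rw [Finset.sum_eq_single 0]
          · simp [m0]
          · intro k hk hk0
            obtain ⟨j, rfl⟩ := Nat.exists_eq_succ_of_ne_zero hk0
            rw [Finset.mem_range] at hk
            rw [Nat.succ_eq_add_one, ih j (by omega), zero_mul]
          · simp
        have := hrec n
        rw [hs] at this
        show m (n + 2) = 0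
        linarith
  have hsc := isProbabilityMeasure_semicircular a hr
  have hscm : ∀ n, ∫ x, chebU a r n x ∂(semicircular a r) = m n := by
    intro n
    have h1 := integral_chebU_mul_chebU (a := a) hr n 0
    simp only [chebU_zero, mul_one] at h1
    rw [h1]
    rcases n with _ | n
    · simp [m0]
    · simp [hzero]
  obtain ⟨R, hR⟩ := (hK.union (isCompact_Icc (a := a - 2 * r) (b := a + 2 * r))).isBounded
    |>.subset_closedBall 0
  rw [Real.closedBall_eq_Icc] at hR
  have hμR := hμ.mono fun x hx => hR (Or.inl hx)
  have hsR := (ae_mem_semicircular a r).mono fun x hx => hR (Or.inr hx)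
  refine ⟨a, r, hr, ext_of_integral_polynomial hμR hsR fun q => ?_⟩
  obtain ⟨N, c, -, hq⟩ := exists_eval_eq_sum_chebU a hr q
  simp_rw [hq]
  rw [integral_finsetSum _ fun k _ => hint (by fun_prop), integral_finsetSum _ fun k _ =>
    integrable_of_continuous_of_ae_mem isCompact_Icc hsR (by fun_prop)]
  refine Finset.sum_congr rfl fun k _ => ?_
  rw [integral_const_mul, integral_const_mul, hscm]

/-! ### Measures with compact support -/

theorem poin_of_isCompact_support [IsProbabilityMeasure μ] (hc : IsCompact μ.support)
    (hd : ∀ a : ℝ, μ ≠ Measure.dirac a) :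
    SatisfiesPoincare μ ∧ IsGreatest (poincareConstants μ) (Poin μ) ∧
      0 < Metric.diam μ.support ∧ 2 / (Metric.diam μ.support) ^ 2 ≤ Poin μ := by
  have hae : ∀ᵐ x ∂μ, x ∈ μ.support := Measure.support_mem_ae
  have hdist : ∀ x ∈ μ.support, ∀ y ∈ μ.support, |y - x| ≤ Metric.diam μ.support :=
    fun x hx y hy => Metric.dist_le_diam_of_mem hc.isBounded hy hx
  have hpos : 0 < Metric.diam μ.support := by
    refine Metric.diam_nonneg.lt_of_ne' fun h0 => ?_
    obtain ⟨a, ha⟩ := Measure.nonempty_support (IsProbabilityMeasure.ne_zero μ)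
    refine hd a (eq_dirac_of_ae_eq ?_)
    filter_upwards [hae] with x hx
    have := hdist a ha x hx
    rw [h0] at this
    exact sub_eq_zero.1 (abs_eq_zero.1 (le_antisymm this (abs_nonneg _)))
  have hP := poincareInequality_two_div_sq hc hae hpos hdist
  have hC : 0 < 2 / (Metric.diam μ.support) ^ 2 := by positivity
  have hs : SatisfiesPoincare μ := ⟨_, hC, hP⟩
  have hg := isGreatest_poin hc hae hs contDiff_id (variance_id_pos hc hae hd)
  exact ⟨hs, hg, hpos, hg.2 ⟨hC, hP⟩⟩

theorem two_div_diam_sq_eq_poin_iff [IsProbabilityMeasure μ] (hc : IsCompact μ.support)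
    (hd : ∀ a : ℝ, μ ≠ Measure.dirac a) :
    2 / (Metric.diam μ.support) ^ 2 = Poin μ ↔ IsTwoPoint μ := by
  obtain ⟨hs, hg, hpos, hle⟩ := poin_of_isCompact_support hc hd
  constructor
  · intro heq
    obtain ⟨α, β, hα, hβ, hsub, hdiam⟩ := diam_support hc
    have hαβ : α < β := by linarith
    refine isTwoPoint_of_support_subset hαβ hα hβ fun c hcs => ?_
    by_contra hne
    simp only [Set.mem_insert_iff, Set.mem_singleton_iff, not_or] at hne
    have hcm := hsub hcs
    have h1 : α < c := hcm.1.lt_of_ne' hne.1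
    have h2 : c < β := hcm.2.lt_of_ne hne.2
    obtain ⟨C, hC, hCP⟩ := exists_poincareInequality_gt hc (d := Metric.diam μ.support)
      (fun x hx y hy => Metric.dist_le_diam_of_mem hc.isBounded hy hx) hcs (fun y hy => by
        have := hsub hy
        rw [hdiam, abs_sub_lt_iff]
        constructor <;> linarith [this.1, this.2])
    have := hg.2 ⟨(by positivity : 0 < 2 / (Metric.diam μ.support) ^ 2).trans hC, hCP⟩
    linarith
  · rintro ⟨α, a, b, h0, h1, hab, rfl⟩
    refine le_antisymm hle ?_
    rw [support_twoPoint h0 h1, Metric.diam_pair, Real.dist_eq, sq_abs]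
    rw [show (a - b) ^ 2 = (b - a) ^ 2 by ring]
    exact le_of_poincareInequality_twoPoint h0 h1 hab hg.1.2

theorem poin_eq_one_div_variance_iff [IsProbabilityMeasure μ] (hc : IsCompact μ.support)
    (hd : ∀ a : ℝ, μ ≠ Measure.dirac a) :
    Poin μ = 1 / variance (fun x : ℝ => x) μ ↔ IsSemicircular μ := by
  obtain ⟨hs, hg, hpos, hle⟩ := poin_of_isCompact_support hc hd
  have hae : ∀ᵐ x ∂μ, x ∈ μ.support := Measure.support_mem_ae
  have hv := variance_id_pos hc hae hd
  constructor
  · intro h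
    exact isSemicircular_of_poincareInequality hc hae hv (h ▸ hg.1.2)
  · rintro ⟨a, r, hr, rfl⟩
    refine le_antisymm (poin_le_inv_variance hc hae hv hg.1.2) (hg.2 ⟨by positivity, ?_⟩)
    rw [variance_semicircular a hr]
    exact poincareInequality_semicircular a hr

end

section

/-! ### Arcsine laws and their logarithmic potential -/

/-- The arcsine law of the interval `[c - h, c + h]`, the distribution of `c + h cos θ` for `θ`
uniform on a full period. -/
noncomputable def arcsine (c h : ℝ) : Measure ℝ :=
  (ENNReal.ofReal (2 * Real.pi)⁻¹ • volume.restrict (Set.Ioc 0 (2 * Real.pi))).map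
    fun θ => c + h * Real.cos θ

instance isProbabilityMeasure_arcsine (c h : ℝ) : IsProbabilityMeasure (arcsine c h) := by
  have h0 : IsProbabilityMeasure
      (ENNReal.ofReal (2 * Real.pi)⁻¹ • volume.restrict (Set.Ioc 0 (2 * Real.pi))) := ⟨by
    have := Real.pi_pos
    rw [Measure.smul_apply, Measure.restrict_apply_univ, Real.volume_Ioc, sub_zero, smul_eq_mul,
      ← ENNReal.ofReal_mul (by positivity), inv_mul_cancel₀ (by positivity), ENNReal.ofReal_one]⟩
  exact Measure.isProbabilityMeasure_map (by fun_prop)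

theorem integral_arcsine (c h : ℝ) {f : ℝ → ℝ} (hf : Measurable f) :
    ∫ x, f x ∂(arcsine c h)
      = (2 * Real.pi)⁻¹ * ∫ θ in (0 : ℝ)..2 * Real.pi, f (c + h * Real.cos θ) := by
  have := Real.pi_pos
  rw [arcsine, integral_map (by fun_prop) hf.aestronglyMeasurable, integral_smul_measure,
    ENNReal.toReal_ofReal (by positivity), intervalIntegral.integral_of_le (by positivity),
    smul_eq_mul]

theorem integrable_arcsine_iff (c h : ℝ) {f : ℝ → ℝ} (hf : Measurable f) :
    Integrable f (arcsine c h)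
      ↔ IntervalIntegrable (fun θ => f (c + h * Real.cos θ)) volume 0 (2 * Real.pi) := by
  have := Real.pi_pos
  rw [arcsine, integrable_map_measure hf.aestronglyMeasurable (by fun_prop),
    intervalIntegrable_iff_integrableOn_Ioc_of_le (by positivity), IntegrableOn,
    integrable_smul_measure (by simpa using this) (by simp)]
  rfl

theorem ae_mem_arcsine (c : ℝ) {h : ℝ} (hh : 0 ≤ h) :
    ∀ᵐ x ∂(arcsine c h), x ∈ Set.Icc (c - h) (c + h) := by
  refine (ae_map_iff (p := fun x => x ∈ Set.Icc (c - h) (c + h)) (by fun_prop)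
    measurableSet_Icc).2 (.of_forall fun θ => ?_)
  have h1 := mul_le_mul_of_nonneg_left (Real.cos_le_one θ) hh
  have h2 := mul_le_mul_of_nonneg_left (Real.neg_one_le_cos θ) hh
  constructor <;> linarith

theorem countable_cos_eq (y : ℝ) : {θ : ℝ | Real.cos θ = y}.Countable := by
  rcases Set.eq_empty_or_nonempty {θ : ℝ | Real.cos θ = y} with h | ⟨θ₀, hθ₀⟩
  · rw [h]
    exact Set.countable_empty
  · refine ((Set.countable_range fun k : ℤ => 2 * k * Real.pi + θ₀).union
      (Set.countable_range fun k : ℤ => 2 * k * Real.pi - θ₀)).mono fun θ hθ => ?_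
    obtain ⟨k, hk⟩ := Real.cos_eq_cos_iff.1 (hθ₀.trans hθ.symm : Real.cos θ₀ = Real.cos θ)
    rcases hk with hk | hk
    · exact Or.inl ⟨k, hk.symm⟩
    · exact Or.inr ⟨k, hk.symm⟩

theorem arcsine_singleton (c : ℝ) {h : ℝ} (hh : 0 < h) (x : ℝ) : arcsine c h {x} = 0 := by
  rw [arcsine, Measure.map_apply (by fun_prop) (measurableSet_singleton x), Measure.smul_apply]
  have : ((fun θ => c + h * Real.cos θ) ⁻¹' {x}) ⊆ {θ : ℝ | Real.cos θ = (x - c) / h} := by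
    intro θ hθ
    have : c + h * Real.cos θ = x := hθ
    show Real.cos θ = _
    rw [← this]
    field_simp
    ring
  rw [((countable_cos_eq _).mono this).measure_zero, smul_zero]

/-- With y = (w + 1/w)/2, (e^{iθ} - w)(e^{-iθ} - w) = 2w (y - cos θ). Conjugating the second factor
turns it into a distance from the same circle point to a fixed point. -/
theorem norm_mul_norm_circleMap {y : ℝ} {w : ℂ} (hw : w ^ 2 + 1 = 2 * y * w) (θ : ℝ) :
    ‖circleMap 0 1 θ - w‖ * ‖circleMap 0 1 θ - (starRingEnd ℂ) w‖
      = 2 * ‖w‖ * |y - Real.cos θ| := by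
  have h1 : ‖circleMap 0 1 θ - (starRingEnd ℂ) w‖ = ‖(starRingEnd ℂ) (circleMap 0 1 θ) - w‖ := by
    rw [← Complex.norm_conj, map_sub, Complex.conj_conj]
  have h2 : (starRingEnd ℂ) (circleMap 0 1 θ) = Complex.exp (-(θ * Complex.I)) := by
    simp [circleMap, ← Complex.exp_conj]
  rw [h1, h2, ← norm_mul, ← Real.norm_eq_abs, ← Complex.norm_real (y - Real.cos θ),
    show (2 : ℝ) = ‖(2 : ℂ)‖ by simp, ← norm_mul, ← norm_mul]
  congr 1
  have h3 : Complex.exp (θ * Complex.I) * Complex.exp (-(θ * Complex.I)) = 1 := by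
    rw [← Complex.exp_add, add_neg_cancel, Complex.exp_zero]
  have h4 : (2 : ℂ) * Complex.cos θ
      = Complex.exp (θ * Complex.I) + Complex.exp (-(θ * Complex.I)) := by
    rw [Complex.two_cos, neg_mul]
  push_cast
  simp only [circleMap, zero_add, Complex.ofReal_one, one_mul]
  linear_combination h3 + hw + w * h4

/-- The kernel splits into log distances from the unit circle to w and its conjugate, each of mean
log⁺|w| by Jensen's formula. Then 2 log⁺|w| - log|w| = |log|w||, which vanishes when |w| = 1. -/
theorem log_potential_arcsine_aux (c : ℝ) {h : ℝ} (hh : 0 < h) {y : ℝ} {w : ℂ} (hw0 : w ≠ 0)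
    (hw : w ^ 2 + 1 = 2 * y * w) :
    Integrable (fun x => Real.log |c + h * y - x|) (arcsine c h) ∧
      ∫ x, Real.log |c + h * y - x| ∂(arcsine c h)
        = Real.log (h / 2) + |Real.log ‖w‖| := by
  have hpi := Real.pi_pos
  have hwn : 0 < ‖w‖ := norm_pos_iff.2 hw0
  have hmeas : Measurable fun x => Real.log |c + h * y - x| := by fun_prop
  have hci : ∀ u : ℂ, IntervalIntegrable (fun θ => Real.log ‖circleMap 0 1 θ - u‖) volume 0
      (2 * Real.pi) := fun u => circleIntegrable_log_norm_sub_const (c := 0) (a := u) 1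
  have hcv : ∀ u : ℂ, ∫ θ in (0 : ℝ)..2 * Real.pi, Real.log ‖circleMap 0 1 θ - u‖
      = 2 * Real.pi * Real.posLog ‖u‖ := by
    intro u
    have := circleAverage_log_norm_sub_const_eq_posLog (a := u)
    rw [Real.circleAverage, smul_eq_mul] at this
    rw [← this]
    field_simp
  have hae : ∀ᵐ θ : ℝ, Real.log |c + h * y - (c + h * Real.cos θ)|
      = (Real.log (h / 2) - Real.log ‖w‖) + (Real.log ‖circleMap 0 1 θ - w‖
        + Real.log ‖circleMap 0 1 θ - (starRingEnd ℂ) w‖) := by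
    -- At these countably many angles the convention `Real.log 0 = 0` breaks the product rule.
    have : ∀ᵐ θ : ℝ, θ ∉ {θ : ℝ | Real.cos θ = y} :=
      measure_eq_zero_iff_ae_notMem.1 ((countable_cos_eq y).measure_zero _)
    filter_upwards [this] with θ hθ
    have hne : y - Real.cos θ ≠ 0 := sub_ne_zero.2 fun e => hθ e.symm
    have hpos : 0 < |y - Real.cos θ| := abs_pos.2 hne
    have hprod := norm_mul_norm_circleMap hw θ
    have hprod0 : ‖circleMap 0 1 θ - w‖ * ‖circleMap 0 1 θ - (starRingEnd ℂ) w‖ ≠ 0 := by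
      rw [hprod]; positivity
    rw [← Real.log_mul (left_ne_zero_of_mul hprod0) (right_ne_zero_of_mul hprod0), hprod,
      ← Real.log_div (by positivity) hwn.ne', ← Real.log_mul (by positivity) (by positivity)]
    congr 1
    rw [show c + h * y - (c + h * Real.cos θ) = h * (y - Real.cos θ) by ring, abs_mul,
      abs_of_pos hh]
    field_simp
  have hint := (intervalIntegrable_const (c := Real.log (h / 2) - Real.log ‖w‖)
    (μ := volume) (a := 0) (b := 2 * Real.pi)).add ((hci w).add (hci ((starRingEnd ℂ) w)))
  constructor
  · rw [integrable_arcsine_iff c h hmeas]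
    refine hint.congr_ae (ae_restrict_of_ae ?_)
    filter_upwards [hae] with θ hθ using hθ.symm
  · rw [integral_arcsine c h hmeas, intervalIntegral.integral_congr_ae
      (by filter_upwards [hae] with θ hθ _ using hθ), intervalIntegral.integral_add
      intervalIntegrable_const ((hci w).add (hci _)), intervalIntegral.integral_add (hci w) (hci _),
      hcv, hcv, Complex.norm_conj, intervalIntegral.integral_const, smul_eq_mul]
    have : |Real.log ‖w‖| = 2 * Real.posLog ‖w‖ - Real.log ‖w‖ := by
      rw [← Real.half_mul_log_add_log_abs]
      ring
    rw [this]
    field_simp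
    ring

theorem exists_joukowsky (y : ℝ) : ∃ w : ℂ, w ≠ 0 ∧ w ^ 2 + 1 = 2 * y * w := by
  obtain ⟨s, hs⟩ := IsAlgClosed.exists_pow_nat_eq ((y : ℂ) ^ 2 - 1) two_pos
  refine ⟨y + s, fun h => ?_, by linear_combination hs⟩
  have : s = -y := by linear_combination h
  rw [this] at hs
  have : (1 : ℂ) = 0 := by linear_combination hs
  exact one_ne_zero this

theorem integrable_log_arcsine (c : ℝ) {h : ℝ} (hh : 0 < h) (z : ℝ) :
    Integrable (fun x => Real.log |z - x|) (arcsine c h) := by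
  obtain ⟨w, hw0, hw⟩ := exists_joukowsky ((z - c) / h)
  have := (log_potential_arcsine_aux c hh hw0 hw).1
  rwa [mul_div_cancel₀ _ hh.ne', add_sub_cancel] at this

theorem le_log_potential_arcsine (c : ℝ) {h : ℝ} (hh : 0 < h) (z : ℝ) :
    Real.log (h / 2) ≤ ∫ x, Real.log |z - x| ∂(arcsine c h) := by
  obtain ⟨w, hw0, hw⟩ := exists_joukowsky ((z - c) / h)
  have := (log_potential_arcsine_aux c hh hw0 hw).2
  rw [mul_div_cancel₀ _ hh.ne', add_sub_cancel] at this
  rw [this]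
  exact le_add_of_nonneg_right (abs_nonneg _)

theorem log_potential_arcsine (c : ℝ) {h : ℝ} (hh : 0 < h) {z : ℝ}
    (hz : z ∈ Set.Icc (c - h) (c + h)) :
    ∫ x, Real.log |z - x| ∂(arcsine c h) = Real.log (h / 2) := by
  set θ := Real.arccos ((z - c) / h)
  have hcos : Real.cos θ = (z - c) / h := Real.cos_arccos
    (by rw [le_div_iff₀ hh]; linarith [hz.1]) (by rw [div_le_iff₀ hh]; linarith [hz.2])
  have hw : Complex.exp (θ * Complex.I) ^ 2 + 1
      = 2 * ((Real.cos θ : ℝ) : ℂ) * Complex.exp (θ * Complex.I) := by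
    have h3 : Complex.exp (θ * Complex.I) * Complex.exp (-(θ * Complex.I)) = 1 := by
      rw [← Complex.exp_add, add_neg_cancel, Complex.exp_zero]
    rw [Complex.ofReal_cos, Complex.two_cos, neg_mul]
    linear_combination -h3
  have := (log_potential_arcsine_aux c hh (Complex.exp_ne_zero _) hw).2
  rw [hcos, mul_div_cancel₀ _ hh.ne', add_sub_cancel, Complex.norm_exp_ofReal_mul_I,
    Real.log_one, abs_zero, add_zero] at this
  exact this

/-- It lets a lower bound on a logarithmic potential control the integral of the absolute value of
the logarithm. -/
theorem abs_log_le {u : ℝ} (hu : 0 ≤ u) : |Real.log u| ≤ 2 * u - Real.log u := by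
  rcases le_total 0 (Real.log u) with h | h
  · rw [abs_of_nonneg h]
    linarith [Real.log_le_self hu]
  · rw [abs_of_nonpos h]
    linarith

theorem integrable_log_prod_arcsine {ν : Measure ℝ} [IsFiniteMeasure ν]
    (hν : Integrable (fun x => x) ν) (c : ℝ) {h : ℝ} (hh : 0 < h) :
    Integrable (fun z : ℝ × ℝ => Real.log |z.1 - z.2|) (ν.prod (arcsine c h)) := by
  have hm : Measurable fun z : ℝ × ℝ => Real.log |z.1 - z.2| := by fun_prop
  rw [integrable_prod_iff hm.aestronglyMeasurable]
  refine ⟨.of_forall fun x => integrable_log_arcsine c hh x, ?_⟩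
  refine Integrable.mono' (g := fun x => 2 * (|x| + |c| + h) - Real.log (h / 2))
    ((((hν.abs.add (integrable_const _)).add (integrable_const _)).const_mul 2).sub
      (integrable_const _))
    hm.aestronglyMeasurable.norm.integral_prod_right' (.of_forall fun x => ?_)
  rw [Real.norm_of_nonneg (integral_nonneg fun _ => norm_nonneg _)]
  have hi : Integrable (fun y => |Real.log (|x - y|)|) (arcsine c h) :=
    (integrable_log_arcsine c hh x).norm
  have hic := (integrable_const (μ := arcsine c h) (2 * (|x| + |c| + h)))
  have : ∫ y, |Real.log (|x - y|)| ∂(arcsine c h)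
      ≤ ∫ y, (2 * (|x| + |c| + h) - Real.log |x - y|) ∂(arcsine c h) := by
    refine integral_mono_ae hi (hic.sub (integrable_log_arcsine c hh x)) ?_
    filter_upwards [ae_mem_arcsine c hh.le] with y hy
    have h1 := abs_log_le (abs_nonneg (x - y))
    have h2 : |x - y| ≤ |x| + |c| + h := by
      have : |y - c| ≤ h := abs_le.2 ⟨by linarith [hy.1], by linarith [hy.2]⟩
      calc |x - y| = |x - c - (y - c)| := by ring_nf
        _ ≤ |x - c| + |y - c| := abs_sub _ _
        _ ≤ |x| + |c| + h := add_le_add (abs_sub _ _) this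
    linarith
  rw [integral_sub hic (integrable_log_arcsine c hh x)] at this
  simp only [integral_const, probReal_univ, one_smul] at this
  exact this.trans (sub_le_sub_left (le_log_potential_arcsine c hh x) _)

theorem prod_diagonal_eq_zero {ν κ : Measure ℝ} [SFinite κ] (h : ∀ x, κ {x} = 0) :
    (ν.prod κ) (Set.diagonal ℝ) = 0 := by
  rw [Measure.measure_prod_null measurableSet_diagonal]
  refine .of_forall fun x => ?_
  have : Prod.mk x ⁻¹' Set.diagonal ℝ = {x} := by
    ext y
    simp [eq_comm]
  show κ (Prod.mk x ⁻¹' Set.diagonal ℝ) = 0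
  rw [this, h]

theorem hasFiniteEnergy_arcsine {V : ℝ → ℝ} (hV : Continuous V) (c : ℝ) {h : ℝ} (hh : 0 < h) :
    HasFiniteEnergy V (arcsine c h) :=
  have hi : ∀ {f : ℝ → ℝ}, Continuous f → Integrable f (arcsine c h) := fun hf =>
    integrable_of_continuous_of_ae_mem isCompact_Icc (ae_mem_arcsine c hh.le) hf
  ⟨hi hV, prod_diagonal_eq_zero (arcsine_singleton c hh),
    integrable_log_prod_arcsine (hi continuous_id') c hh⟩

theorem integral_cos_pow_two_mul (p : ℕ) :
    ∫ θ in (0 : ℝ)..2 * Real.pi, Real.cos θ ^ (2 * p)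
      = 2 * Real.pi * ((Nat.choose (2 * p) p : ℝ) / 4 ^ p) := by
  rw [← Nat.centralBinom]
  induction p with
  | zero => simp
  | succ p ih =>
    rw [show 2 * (p + 1) = 2 * p + 2 by ring, integral_cos_pow, ih]
    have := Nat.succ_mul_centralBinom_succ p
    have h1 : ((p : ℝ) + 1) * (Nat.centralBinom (p + 1) : ℝ)
        = 2 * (2 * p + 1) * Nat.centralBinom p := by exact_mod_cast this
    have h2 : (Nat.centralBinom (p + 1) : ℝ) = 2 * (2 * p + 1) * Nat.centralBinom p / (p + 1) := by
      rw [eq_div_iff (by positivity)]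
      linarith
    rw [h2]
    simp
    field_simp
    ring

end

section

/-! ### The first variation of the logarithmic energy -/

variable {μ ν : Measure ℝ} {V : ℝ → ℝ}

theorem prod_mixture [IsFiniteMeasure μ] [IsFiniteMeasure ν] (a b : ℝ) :
    (ENNReal.ofReal a • μ + ENNReal.ofReal b • ν).prod (ENNReal.ofReal a • μ + ENNReal.ofReal b • ν)
      = (ENNReal.ofReal a • ENNReal.ofReal a • μ.prod μ
          + ENNReal.ofReal a • ENNReal.ofReal b • μ.prod ν)
        + (ENNReal.ofReal b • ENNReal.ofReal a • ν.prod μ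
          + ENNReal.ofReal b • ENNReal.ofReal b • ν.prod ν) := by
  have := Measure.smul_finite μ (ENNReal.ofReal_ne_top (r := a))
  have := Measure.smul_finite ν (ENNReal.ofReal_ne_top (r := b))
  rw [Measure.add_prod, Measure.prod_add, Measure.prod_add, Measure.prod_smul_left,
    Measure.prod_smul_left, Measure.prod_smul_left, Measure.prod_smul_left,
    Measure.prod_smul_right, Measure.prod_smul_right, Measure.prod_smul_right,
    Measure.prod_smul_right]

theorem integral_prod_log_comm [SFinite μ] [SFinite ν] :
    ∫ z : ℝ × ℝ, Real.log |z.1 - z.2| ∂(μ.prod ν)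
      = ∫ z : ℝ × ℝ, Real.log |z.1 - z.2| ∂(ν.prod μ) := by
  rw [← integral_prod_swap]
  simp [abs_sub_comm]

theorem integrable_prod_log_comm [SFinite μ] [SFinite ν]
    (h : Integrable (fun z : ℝ × ℝ => Real.log |z.1 - z.2|) (ν.prod μ)) :
    Integrable (fun z : ℝ × ℝ => Real.log |z.1 - z.2|) (μ.prod ν) := by
  refine h.swap.congr (.of_forall fun z => ?_)
  show Real.log |z.2 - z.1| = Real.log |z.1 - z.2|
  rw [abs_sub_comm]

/-- An arcsine law is a competitor of finite energy. -/
theorem IsEquilibriumMeasure.hasFiniteEnergy (hV : Continuous V) (h : IsEquilibriumMeasure V μ) :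
    HasFiniteEnergy V μ := by
  by_contra hμ
  have h1 := h.2 (arcsine 0 1) inferInstance
  rw [logEnergy, logEnergy, if_neg hμ, if_pos (hasFiniteEnergy_arcsine hV 0 one_pos)] at h1
  exact absurd (top_le_iff.1 h1) (EReal.coe_ne_top _)

theorem HasFiniteEnergy.singleton [SFinite μ] (h : HasFiniteEnergy V μ) (x : ℝ) : μ {x} = 0 := by
  by_contra hne
  have h1 := h.2.1
  rw [Measure.measure_prod_null measurableSet_diagonal] at h1
  have : ∃ᶠ y in ae μ, y = x := fun h2 => hne (by
    rw [ae_iff] at h2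
    convert h2 using 2
    ext y
    simp)
  obtain ⟨y, rfl, hy⟩ := (this.and_eventually h1).exists
  have e : Prod.mk y ⁻¹' Set.diagonal ℝ = {y} := by
    ext z
    simp [eq_comm]
  have hy' : μ (Prod.mk y ⁻¹' Set.diagonal ℝ) = 0 := hy
  rw [e] at hy'
  exact hne hy'

/-- The first-order condition for a minimizer of the logarithmic energy in the direction `ν - μ`. -/
theorem IsEquilibriumMeasure.first_variation [IsProbabilityMeasure ν] (hV : Continuous V)
    (h : IsEquilibriumMeasure V μ) (hν : HasFiniteEnergy V ν)
    (hmix : Integrable (fun z : ℝ × ℝ => Real.log |z.1 - z.2|) (ν.prod μ)) :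
    (∫ x, V x ∂μ) - 2 * ∫ z : ℝ × ℝ, Real.log |z.1 - z.2| ∂(μ.prod μ)
      ≤ (∫ x, V x ∂ν) - 2 * ∫ z : ℝ × ℝ, Real.log |z.1 - z.2| ∂(ν.prod μ) := by
  have hμp := h.1
  have hμ := h.hasFiniteEnergy hV
  set L : ℝ × ℝ → ℝ := fun z => Real.log |z.1 - z.2| with hL
  -- Along (1 - t)μ + tν the energy changes by t(A + tB).
  set A := ((∫ x, V x ∂ν) - 2 * ∫ z, L z ∂(ν.prod μ)) - ((∫ x, V x ∂μ) - 2 * ∫ z, L z ∂(μ.prod μ))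
    with hA
  set B := 2 * (∫ z, L z ∂(ν.prod μ)) - (∫ z, L z ∂(μ.prod μ)) - ∫ z, L z ∂(ν.prod ν) with hB
  have hmix' : Integrable L (μ.prod ν) := integrable_prod_log_comm hmix
  have key : ∀ t : ℝ, 0 < t → t < 1 → 0 ≤ A + t * B := by
    intro t ht0 ht1
    have ht : 0 ≤ 1 - t := by linarith
    set κ := ENNReal.ofReal (1 - t) • μ + ENNReal.ofReal t • ν with hκ
    have hκp : IsProbabilityMeasure κ := ⟨by
      simp [hκ, ← ENNReal.ofReal_add ht ht0.le]⟩
    have s : ∀ {X : Type} [MeasurableSpace X] {κ' : Measure X} {f : X → ℝ} (c : ℝ),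
        Integrable f κ' → Integrable f (ENNReal.ofReal c • κ') := fun c hf =>
      hf.smul_measure ENNReal.ofReal_ne_top
    have hκκ := prod_mixture (μ := μ) (ν := ν) (1 - t) t
    rw [← hκ] at hκκ
    have i1 := s (1 - t) (s (1 - t) hμ.2.2)
    have i2 := s (1 - t) (s t hmix')
    have i3 := s t (s (1 - t) hmix)
    have i4 := s t (s t hν.2.2)
    have hκE : HasFiniteEnergy V κ := by
      refine ⟨(s _ hμ.1).add_measure (s _ hν.1), ?_, ?_⟩
      · refine prod_diagonal_eq_zero fun x => ?_
        simp [hκ, hμ.singleton x, hν.singleton x]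
      · rw [hκκ]
        exact (i1.add_measure i2).add_measure (i3.add_measure i4)
    have hle := h.2 κ hκp
    rw [logEnergy, logEnergy, if_pos hμ, if_pos hκE, EReal.coe_le_coe_iff, hκκ,
      integral_add_measure (i1.add_measure i2) (i3.add_measure i4), integral_add_measure i1 i2,
      integral_add_measure i3 i4, hκ, integral_add_measure (s _ hμ.1) (s _ hν.1)] at hle
    simp only [integral_smul_measure, ENNReal.toReal_ofReal ht, ENNReal.toReal_ofReal ht0.le,
      smul_eq_mul] at hle
    rw [integral_prod_log_comm (μ := μ) (ν := ν)] at hle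
    have : 0 ≤ t * (A + t * B) := by
      simp only [hA, hB, hL]
      linarith
    exact nonneg_of_mul_nonneg_right this ht0
  have hlim : Filter.Tendsto (fun t : ℝ => A + t * B) (nhdsWithin 0 (Set.Ioi 0)) (nhds A) := by
    have : Continuous fun t : ℝ => A + t * B := by fun_prop
    have := this.tendsto 0
    rw [zero_mul, add_zero] at this
    exact this.mono_left nhdsWithin_le_nhds
  have hA0 : 0 ≤ A := by
    refine ge_of_tendsto hlim ?_
    filter_upwards [Ioo_mem_nhdsGT (zero_lt_one' ℝ)] with t ht using key t ht.1 ht.2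
  linarith

/-- Euler–Lagrange equality, almost everywhere for the equilibrium measure. -/
theorem IsEquilibriumMeasure.ae_eq (hV : Continuous V) (h : IsEquilibriumMeasure V μ) :
    ∀ᵐ x ∂μ, V x - 2 * ∫ y, Real.log |x - y| ∂μ
      = (∫ x, V x ∂μ) - 2 * ∫ z : ℝ × ℝ, Real.log |z.1 - z.2| ∂(μ.prod μ) := by
  have hμp := h.1
  have hμ := h.hasFiniteEnergy hV
  set ℓ := (∫ x, V x ∂μ) - 2 * ∫ z : ℝ × ℝ, Real.log |z.1 - z.2| ∂(μ.prod μ) with hℓ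
  have hU : Integrable (fun x => ∫ y, Real.log |x - y| ∂μ) μ := hμ.2.2.integral_prod_left
  have hint : Integrable (fun x => V x - 2 * ∫ y, Real.log |x - y| ∂μ) μ :=
    hμ.1.sub (hU.const_mul 2)
  have hf : Integrable (fun x => (V x - 2 * ∫ y, Real.log |x - y| ∂μ) - ℓ) μ :=
    hint.sub (integrable_const ℓ)
  have hzero : ∫ x, ((V x - 2 * ∫ y, Real.log |x - y| ∂μ) - ℓ) ∂μ = 0 := by
    rw [integral_sub hint (integrable_const ℓ), integral_sub hμ.1 (hU.const_mul 2),
      integral_const_mul, hℓ, integral_prod _ hμ.2.2]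
    simp
  -- Taking the normalized restriction of μ to `A` as the competitor shows that the effective
  -- potential is at least ℓ almost everywhere. Its μ-mean is ℓ, so equality holds.
  have hnn : 0 ≤ᵐ[μ] fun x => (V x - 2 * ∫ y, Real.log |x - y| ∂μ) - ℓ := by
    refine ae_nonneg_of_forall_setIntegral_nonneg hf fun A hA _ => ?_
    rcases eq_or_ne (μ A) 0 with h0 | h0
    · rw [Measure.restrict_eq_zero.2 h0, integral_zero_measure]
    · have hcp : IsProbabilityMeasure (cond μ A) := cond_isProbabilityMeasure h0
      have hc : (μ A)⁻¹ ≠ ⊤ := ENNReal.inv_ne_top.2 h0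
      have e1 : (cond μ A).prod μ = (μ A)⁻¹ • (μ.prod μ).restrict (A ×ˢ Set.univ) := by
        rw [ProbabilityTheory.cond, Measure.prod_smul_left, ← Measure.prod_restrict,
          Measure.restrict_univ]
      have e2 : (cond μ A).prod (cond μ A)
          = (μ A)⁻¹ • (μ A)⁻¹ • (μ.prod μ).restrict (A ×ˢ A) := by
        rw [ProbabilityTheory.cond, Measure.prod_smul_left, Measure.prod_smul_right,
          Measure.prod_restrict]
      have hE : HasFiniteEnergy V (cond μ A) := by
        refine ⟨hμ.1.restrict.smul_measure hc, prod_diagonal_eq_zero fun x => ?_, ?_⟩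
        · exact cond_absolutelyContinuous (hμ.singleton x)
        · rw [e2]
          exact (hμ.2.2.restrict.smul_measure hc).smul_measure hc
      have hmix : Integrable (fun z : ℝ × ℝ => Real.log |z.1 - z.2|) ((cond μ A).prod μ) := by
        rw [e1]
        exact hμ.2.2.restrict.smul_measure hc
      have hfv := h.first_variation hV hE hmix
      have hUc : Integrable (fun x => ∫ y, Real.log |x - y| ∂μ) (cond μ A) :=
        hU.restrict.smul_measure hc
      rw [← hℓ, integral_prod _ hmix, ← integral_const_mul, ← integral_sub hE.1 (hUc.const_mul 2),
        ProbabilityTheory.cond, integral_smul_measure, smul_eq_mul, ENNReal.toReal_inv] at hfv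
      have hA0 : 0 < μ.real A := ENNReal.toReal_pos h0 (measure_ne_top _ _)
      change ℓ ≤ (μ.real A)⁻¹ * _ at hfv
      rw [le_inv_mul_iff₀ hA0] at hfv
      rw [integral_sub hint.integrableOn (integrable_const ℓ), setIntegral_const, smul_eq_mul]
      linarith
  have h3 := (integral_eq_zero_iff_of_nonneg_ae hnn hf).1 hzero
  filter_upwards [h3] with x hx
  exact sub_eq_zero.1 hx

end

section

/-! ### The support of the equilibrium measure -/

variable {μ ν : Measure ℝ} {V : ℝ → ℝ} {p : ℕ} {ρ : ℝ}

theorem convexOn_of_sub_pow (hρ : 0 < ρ)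
    (hc : ConvexOn ℝ Set.univ fun x : ℝ => V x - ρ * x ^ (2 * p)) : ConvexOn ℝ Set.univ V := by
  have h := hc.add (((even_two_mul p).convexOn_pow (𝕜 := ℝ)).smul hρ.le)
  exact h.congr fun x _ => by simp

/-- The convex remainder lies above its tangent at 0, and x^{2p} ≥ x² - 1. Half of ρx² is kept; the
other half absorbs the linear term by completing the square. -/
theorem exists_quadratic_le (hV : Differentiable ℝ V) (hp : 1 ≤ p) (hρ : 0 < ρ)
    (hc : ConvexOn ℝ Set.univ fun x : ℝ => V x - ρ * x ^ (2 * p)) :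
    ∃ C, ∀ x, ρ / 2 * x ^ 2 - C ≤ V x := by
  set W := fun x : ℝ => V x - ρ * x ^ (2 * p) with hW
  have hWd : DifferentiableAt ℝ W 0 := by fun_prop
  have htan : ∀ x, W 0 + deriv W 0 * x ≤ W x := by
    intro x
    rcases lt_trichotomy x 0 with hx | rfl | hx
    · have := hc.slope_le_deriv (Set.mem_univ x) (Set.mem_univ 0) hx hWd
      rw [slope_def_field, zero_sub, div_le_iff₀ (by linarith)] at this
      linarith
    · simp
    · have := hc.deriv_le_slope (Set.mem_univ 0) (Set.mem_univ x) hx hWd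
      rw [slope_def_field, sub_zero, le_div_iff₀ hx] at this
      linarith
  refine ⟨ρ + (deriv W 0) ^ 2 / (2 * ρ) - W 0, fun x => ?_⟩
  have h1 := htan x
  have h2 : x ^ 2 - 1 ≤ x ^ (2 * p) := by
    rw [pow_mul]
    rcases le_total 1 (x ^ 2) with h | h
    · linarith [le_self_pow₀ h (by omega : p ≠ 0)]
    · linarith [pow_nonneg (sq_nonneg x) p]
  have h3 := mul_le_mul_of_nonneg_left h2 hρ.le
  have h4 : 0 ≤ ρ / 2 * x ^ 2 + deriv W 0 * x + (deriv W 0) ^ 2 / (2 * ρ) := by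
    have : ρ / 2 * x ^ 2 + deriv W 0 * x + (deriv W 0) ^ 2 / (2 * ρ)
        = (ρ * x + deriv W 0) ^ 2 / (2 * ρ) := by field_simp; ring
    rw [this]
    positivity
  have h5 : V x = W x + ρ * x ^ (2 * p) := by simp [hW]
  linarith

theorem integrable_id_of_quadratic_le [IsFiniteMeasure μ] {C : ℝ} (hρ : 0 < ρ)
    (hC : ∀ x, ρ / 2 * x ^ 2 - C ≤ V x) (hV : Integrable V μ) : Integrable (fun x => x) μ := by
  refine Integrable.mono' (g := fun x => (V x + C) / ρ + 1 / 2)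
    (((hV.add (integrable_const C)).div_const ρ).add (integrable_const _))
    measurable_id'.aestronglyMeasurable (.of_forall fun x => ?_)
  have h1 : x ^ 2 / 2 ≤ (V x + C) / ρ := by
    rw [le_div_iff₀ hρ]
    linarith [hC x]
  have h2 : |x| ≤ x ^ 2 / 2 + 1 / 2 := by
    rw [← sq_abs]
    nlinarith [sq_nonneg (|x| - 1)]
  rw [Real.norm_eq_abs]
  linarith

theorem integral_log_le [IsProbabilityMeasure μ] (hμ : Integrable (fun x => x) μ) {x : ℝ}
    (hx : Integrable (fun y => Real.log |x - y|) μ) :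
    ∫ y, Real.log |x - y| ∂μ ≤ |x| + ∫ y, |y| ∂μ := by
  have : ∫ y, (|x| + |y|) ∂μ = |x| + ∫ y, |y| ∂μ := by
    rw [integral_add (integrable_const _) hμ.abs]
    simp
  rw [← this]
  refine integral_mono hx ((integrable_const _).add hμ.abs) fun y => ?_
  exact (Real.log_le_self (abs_nonneg _)).trans (abs_sub _ _)

/-- The points where the effective potential of `μ` is finite and at most `ℓ`. -/
def contactSet (V : ℝ → ℝ) (μ : Measure ℝ) (ℓ : ℝ) : Set ℝ :=
  {x | Integrable (fun y => Real.log |x - y|) μ ∧ V x - 2 * ∫ y, Real.log |x - y| ∂μ ≤ ℓ}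

theorem exists_contactSet_subset [IsProbabilityMeasure μ] {C : ℝ} (hρ : 0 < ρ)
    (hC : ∀ x, ρ / 2 * x ^ 2 - C ≤ V x) (hμ : Integrable (fun x => x) μ) (ℓ : ℝ) :
    ∃ R, contactSet V μ ℓ ⊆ Set.Icc (-R) R := by
  set M := ∫ y, |y| ∂μ
  set D := |C + ℓ + 2 * M| with hD
  refine ⟨4 / ρ + 2 * D / ρ + 1, fun x hx => abs_le.1 ?_⟩
  have h1 := integral_log_le hμ hx.1
  have h2 := hC x
  have h3 := hx.2
  have h4 : ρ / 2 * |x| ^ 2 ≤ 2 * |x| + D := by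
    rw [sq_abs]
    have := le_abs_self (C + ℓ + 2 * M)
    linarith
  by_contra! hlt
  have hD0 : 0 ≤ D := abs_nonneg _
  have h6 : (1 : ℝ) ≤ |x| := by
    have : 0 ≤ 4 / ρ + 2 * D / ρ := by positivity
    linarith
  have h7 : 4 + 2 * D < ρ * |x| := by
    have : ρ * (4 / ρ + 2 * D / ρ + 1) < ρ * |x| := mul_lt_mul_of_pos_left hlt hρ
    have e : ρ * (4 / ρ + 2 * D / ρ + 1) = 4 + 2 * D + ρ := by field_simp
    linarith
  nlinarith

/-- Fatou's lemma for M - log|u_n - y| ≥ 0 gives lower semicontinuity of the effective potential,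
and integrability at the limit too. Pointwise convergence fails only at y = x, which is not an atom.
-/
theorem isClosed_contactSet [IsProbabilityMeasure μ] (hV : Continuous V) (h0 : ∀ x, μ {x} = 0)
    {R : ℝ} (hR : ∀ᵐ y ∂μ, y ∈ Set.Icc (-R) R) (ℓ : ℝ) : IsClosed (contactSet V μ ℓ) := by
  refine IsSeqClosed.isClosed fun u x hu hx => ?_
  obtain ⟨T, hT⟩ := (Metric.isBounded_range_of_tendsto u hx).subset_closedBall 0
  have hT' : ∀ n, |u n| ≤ T := fun n => by
    simpa using hT (Set.mem_range_self n)
  set M := T + |R| with hM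
  have hlogle : ∀ n, ∀ y ∈ Set.Icc (-R) R, Real.log |u n - y| ≤ M := by
    intro n y hy
    have h1 : |y| ≤ |R| := (abs_le.2 hy).trans (le_abs_self R)
    exact (Real.log_le_self (abs_nonneg _)).trans ((abs_sub _ _).trans (add_le_add (hT' n) h1))
  have hpt : ∀ y, y ≠ x → Filter.Tendsto (fun n => M - Real.log |u n - y|) Filter.atTop
      (nhds (M - Real.log |x - y|)) := by
    intro y hy
    refine Filter.Tendsto.const_sub M (Filter.Tendsto.log ?_ ?_)
    · exact (hx.sub_const y).abs
    · exact abs_ne_zero.2 (sub_ne_zero.2 hy.symm)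
  have hne : ∀ᵐ y ∂μ, y ≠ x := by
    rw [ae_iff]
    simpa using h0 x
  have hxle : ∀ᵐ y ∂μ, 0 ≤ M - Real.log |x - y| := by
    filter_upwards [hne, hR] with y hy hyR
    exact ge_of_tendsto' (hpt y hy) fun n => sub_nonneg.2 (hlogle n y hyR)
  set b : ℕ → ℝ := fun n => M - (V (u n) - ℓ) / 2 with hb
  have hb_lim : Filter.Tendsto b Filter.atTop (nhds (M - (V x - ℓ) / 2)) :=
    (((hV.tendsto x).comp hx).sub_const ℓ).div_const 2 |>.const_sub M
  have hun : ∀ n, ∫ y, (M - Real.log |u n - y|) ∂μ ≤ b n := by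
    intro n
    have h2 := (hu n).2
    rw [integral_sub (integrable_const M) (hu n).1]
    simp only [integral_const, probReal_univ, one_smul, hb]
    linarith
  have hnn : ∀ n, 0 ≤ᵐ[μ] fun y => M - Real.log |u n - y| := fun n => by
    filter_upwards [hR] with y hy using sub_nonneg.2 (hlogle n y hy)
  have hfatou : ∫⁻ y, ENNReal.ofReal (M - Real.log |x - y|) ∂μ
      ≤ ENNReal.ofReal (M - (V x - ℓ) / 2) := by
    calc ∫⁻ y, ENNReal.ofReal (M - Real.log |x - y|) ∂μ
        = ∫⁻ y, Filter.liminf (fun n => ENNReal.ofReal (M - Real.log |u n - y|))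
            Filter.atTop ∂μ := by
          refine lintegral_congr_ae ?_
          filter_upwards [hne] with y hy
          exact ((ENNReal.continuous_ofReal.tendsto _).comp (hpt y hy)).liminf_eq.symm
      _ ≤ Filter.liminf (fun n => ∫⁻ y, ENNReal.ofReal (M - Real.log |u n - y|) ∂μ) Filter.atTop :=
          lintegral_liminf_le fun n => by fun_prop
      _ ≤ Filter.liminf (fun n => ENNReal.ofReal (b n)) Filter.atTop := by
          refine Filter.liminf_le_liminf (.of_forall fun n => ?_)
          rw [← ofReal_integral_eq_lintegral_ofReal (f := fun y => M - Real.log |u n - y|)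
            ((integrable_const M).sub (hu n).1) (hnn n)]
          exact ENNReal.ofReal_le_ofReal (hun n)
      _ = ENNReal.ofReal (M - (V x - ℓ) / 2) :=
          ((ENNReal.continuous_ofReal.tendsto _).comp hb_lim).liminf_eq
  have hb0 : 0 ≤ M - (V x - ℓ) / 2 :=
    ge_of_tendsto' hb_lim fun n => (integral_nonneg_of_ae (hnn n)).trans (hun n)
  have hmeas : AEStronglyMeasurable (fun y => M - Real.log |x - y|) μ :=
    Measurable.aestronglyMeasurable (by fun_prop)
  have hint : Integrable (fun y => M - Real.log |x - y|) μ := by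
    refine ⟨hmeas, ?_⟩
    rw [hasFiniteIntegral_iff_ofReal hxle]
    exact hfatou.trans_lt ENNReal.ofReal_lt_top
  have hlogint : Integrable (fun y => Real.log |x - y|) μ := by
    have := (integrable_const (μ := μ) M).sub hint
    refine this.congr (.of_forall fun y => ?_)
    simp
  refine ⟨hlogint, ?_⟩
  have h5 : ∫ y, (M - Real.log |x - y|) ∂μ ≤ M - (V x - ℓ) / 2 := by
    rw [← ENNReal.ofReal_le_ofReal_iff hb0, ofReal_integral_eq_lintegral_ofReal hint hxle]
    exact hfatou
  rw [integral_sub (integrable_const M) hlogint] at h5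
  simp only [integral_const, probReal_univ, one_smul] at h5
  linarith

/-- For y outside (u, v) the distance to y is affine on [u, v], and log is concave. -/
theorem log_concave_of_notMem_Ioo {u v y s t : ℝ} (hu : y ≠ u) (hv : y ≠ v)
    (hy : y ≤ u ∨ v ≤ y) (huv : u ≤ v) (hs : 0 ≤ s) (ht : 0 ≤ t) (hst : s + t = 1) :
    s * Real.log |u - y| + t * Real.log |v - y| ≤ Real.log |s * u + t * v - y| := by
  have hu' : 0 < |u - y| := abs_pos.2 (sub_ne_zero.2 hu.symm)
  have hv' : 0 < |v - y| := abs_pos.2 (sub_ne_zero.2 hv.symm)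
  have h := strictConcaveOn_log_Ioi.concaveOn.2 (Set.mem_Ioi.2 hu') (Set.mem_Ioi.2 hv') hs ht hst
  simp only [smul_eq_mul] at h
  have e0 : s * u + t * v - y = s * (u - y) + t * (v - y) := by linear_combination y * hst
  have e : |s * u + t * v - y| = s * |u - y| + t * |v - y| := by
    rw [e0]
    rcases hy with hy | hy
    · rw [abs_of_nonneg (sub_nonneg.2 hy), abs_of_nonneg (sub_nonneg.2 (hy.trans huv)),
        abs_of_nonneg]
      exact add_nonneg (mul_nonneg hs (sub_nonneg.2 hy))
        (mul_nonneg ht (sub_nonneg.2 (hy.trans huv)))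
    · rw [abs_of_nonpos (sub_nonpos.2 hy), abs_of_nonpos (sub_nonpos.2 (huv.trans hy)),
        abs_of_nonpos]
      · ring
      · exact add_nonpos (mul_nonpos_of_nonneg_of_nonpos hs (sub_nonpos.2 (huv.trans hy)))
          (mul_nonpos_of_nonneg_of_nonpos ht (sub_nonpos.2 hy))
  rw [e]
  exact h

/-- The contact set contains the gaps of any closed subset carrying `μ`. -/
theorem mem_contactSet_of_gap [IsProbabilityMeasure μ] (hV : ConvexOn ℝ Set.univ V)
    (h0 : ∀ x, μ {x} = 0) (hμ : Integrable (fun x => x) μ) {ℓ u v x : ℝ}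
    (hu : u ∈ contactSet V μ ℓ) (hv : v ∈ contactSet V μ ℓ) (hux : u < x) (hxv : x < v)
    (hgap : ∀ᵐ y ∂μ, y ≤ u ∨ v ≤ y) : x ∈ contactSet V μ ℓ := by
  set s := (v - x) / (v - u) with hs
  set t := (x - u) / (v - u) with ht
  have huv : 0 < v - u := by linarith
  have hs0 : 0 ≤ s := div_nonneg (by linarith) huv.le
  have ht0 : 0 ≤ t := div_nonneg (by linarith) huv.le
  have hst : s + t = 1 := by
    rw [hs, ht]
    field_simp
    ring
  have hx : s * u + t * v = x := by
    rw [hs, ht]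
    field_simp
    ring
  have hne : ∀ z, ∀ᵐ y ∂μ, y ≠ z := fun z => by
    rw [ae_iff]
    simpa using h0 z
  -- No mass lies in the gap, so the potential is concave there. This lower bound, with the linear
  -- upper bound on log, also gives integrability at x.
  have hlow : ∀ᵐ y ∂μ, s * Real.log |u - y| + t * Real.log |v - y| ≤ Real.log |x - y| := by
    filter_upwards [hgap, hne u, hne v] with y hy hyu hyv
    rw [← hx]
    exact log_concave_of_notMem_Ioo hyu hyv hy (by linarith) hs0 ht0 hst
  have hlowint : Integrable (fun y => s * Real.log |u - y| + t * Real.log |v - y|) μ :=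
    (hu.1.const_mul s).add (hv.1.const_mul t)
  have hint : Integrable (fun y => Real.log |x - y|) μ := by
    refine Integrable.mono' (g := fun y =>
        abs (s * Real.log |u - y| + t * Real.log |v - y|) + (|x| + |y|))
      (hlowint.abs.add ((integrable_const _).add hμ.abs))
      (Measurable.aestronglyMeasurable (by fun_prop)) ?_
    filter_upwards [hlow] with y hy
    have h1 := (Real.log_le_self (abs_nonneg (x - y))).trans (abs_sub x y)
    rw [Real.norm_eq_abs, abs_le]
    have h2 := neg_abs_le (s * Real.log |u - y| + t * Real.log |v - y|)
    have h3 := abs_nonneg (s * Real.log |u - y| + t * Real.log |v - y|)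
    constructor <;> linarith [abs_nonneg x, abs_nonneg y]
  refine ⟨hint, ?_⟩
  have h1 := integral_mono_ae hlowint hint hlow
  rw [integral_add (hu.1.const_mul s) (hv.1.const_mul t), integral_const_mul,
    integral_const_mul] at h1
  have h2 := hV.2 (Set.mem_univ u) (Set.mem_univ v) hs0 ht0 hst
  simp only [smul_eq_mul, hx] at h2
  have h3 := mul_le_mul_of_nonneg_left hu.2 hs0
  have h4 := mul_le_mul_of_nonneg_left hv.2 ht0
  have h5 : s * ℓ + t * ℓ = ℓ := by rw [← add_mul, hst, one_mul]
  linarith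

theorem Icc_subset_contactSet [IsProbabilityMeasure μ] (hV : ConvexOn ℝ Set.univ V)
    (h0 : ∀ x, μ {x} = 0) (hμ : Integrable (fun x => x) μ) {ℓ α β : ℝ}
    (hc : IsCompact μ.support) (hs : μ.support ⊆ contactSet V μ ℓ)
    (hα : α ∈ μ.support) (hβ : β ∈ μ.support) : Set.Icc α β ⊆ contactSet V μ ℓ := by
  intro x hx
  by_cases hxs : x ∈ μ.support
  · exact hs hxs
  have hL : IsCompact (μ.support ∩ Set.Iic x) := hc.inter_right isClosed_Iic
  have hR : IsCompact (μ.support ∩ Set.Ici x) := hc.inter_right isClosed_Ici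
  have hu := hL.sSup_mem ⟨α, hα, hx.1⟩
  have hv := hR.sInf_mem ⟨β, hβ, hx.2⟩
  have hux : sSup (μ.support ∩ Set.Iic x) < x :=
    lt_of_le_of_ne hu.2 fun e => hxs (e ▸ hu.1)
  have hxv : x < sInf (μ.support ∩ Set.Ici x) :=
    lt_of_le_of_ne hv.2 fun e => hxs (e ▸ hv.1)
  refine mem_contactSet_of_gap hV h0 hμ (hs hu.1) (hs hv.1) hux hxv ?_
  filter_upwards [Measure.support_mem_ae (μ := μ)] with y hy
  rcases le_total y x with h | h
  · exact Or.inl (le_csSup hL.bddAbove ⟨hy, h⟩)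
  · exact Or.inr (csInf_le hR.bddBelow ⟨hy, h⟩)

/-- For a convex, quadratically growing field, the equilibrium measure has compact support, and the
convex hull of the support lies in the contact set. -/
theorem IsEquilibriumMeasure.isCompact_support {C : ℝ} (hVc : Continuous V) (hρ : 0 < ρ)
    (hC : ∀ x, ρ / 2 * x ^ 2 - C ≤ V x) (h : IsEquilibriumMeasure V μ) :
    IsCompact μ.support ∧ μ.support ⊆ contactSet V μ
      ((∫ x, V x ∂μ) - 2 * ∫ z : ℝ × ℝ, Real.log |z.1 - z.2| ∂(μ.prod μ)) := by
  have hμp := h.1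
  have hE := h.hasFiniteEnergy hVc
  have hid := integrable_id_of_quadratic_le hρ hC hE.1
  set ℓ := (∫ x, V x ∂μ) - 2 * ∫ z : ℝ × ℝ, Real.log |z.1 - z.2| ∂(μ.prod μ)
  have hae : ∀ᵐ x ∂μ, x ∈ contactSet V μ ℓ := by
    filter_upwards [h.ae_eq hVc, hE.2.2.prod_right_ae] with x hx hx' using ⟨hx', hx.le⟩
  -- Boundedness comes first, as closedness of the contact set uses that μ lives on a bounded
  -- interval.
  obtain ⟨R, hR⟩ := exists_contactSet_subset hρ hC hid ℓ
  have haeR := hae.mono hR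
  have hsub := Measure.support_subset_of_isClosed
    (isClosed_contactSet hVc hE.singleton haeR ℓ) hae
  exact ⟨isCompact_Icc.of_isClosed_subset Measure.isClosed_support (hsub.trans hR), hsub⟩

end

section

/-! ### The diameter of the support of the equilibrium measure -/

variable {μ : Measure ℝ} {V : ℝ → ℝ} {p : ℕ} {ρ : ℝ}

/-- In the binomial expansion odd powers of t cancel and even ones have nonnegative coefficients.
Only the top term is kept; it does not involve the centre c. -/
theorem two_mul_pow_le_symm_diff (p : ℕ) (c t : ℝ) {s : ℝ} (hs0 : 0 ≤ s) (hs1 : s ≤ 1) :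
    2 * t ^ (2 * p) * (1 - s ^ (2 * p)) ≤ (c + t) ^ (2 * p) + (c - t) ^ (2 * p)
      - (c + s * t) ^ (2 * p) - (c - s * t) ^ (2 * p) := by
  have h : (c + t) ^ (2 * p) + (c - t) ^ (2 * p) - (c + s * t) ^ (2 * p) - (c - s * t) ^ (2 * p)
      = ∑ j ∈ Finset.range (2 * p + 1), (1 - s ^ j) * (t ^ j + (-t) ^ j) * c ^ (2 * p - j)
        * ((2 * p).choose j) := by
    rw [add_comm c t, show c - t = -t + c by ring, add_comm c (s * t),
      show c - s * t = s * (-t) + c by ring, add_pow, add_pow, add_pow, add_pow,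
      ← Finset.sum_add_distrib, ← Finset.sum_sub_distrib, ← Finset.sum_sub_distrib]
    refine Finset.sum_congr rfl fun j _ => ?_
    rw [mul_pow, mul_pow]
    ring
  have hterm : ∀ j ∈ Finset.range (2 * p + 1), 0 ≤ (1 - s ^ j) * (t ^ j + (-t) ^ j)
      * c ^ (2 * p - j) * ((2 * p).choose j) := by
    intro j _
    rcases Nat.even_or_odd j with hj | hj
    · have h1 : 0 ≤ 1 - s ^ j := sub_nonneg.2 (pow_le_one₀ hs0 hs1)
      have h2 : 0 ≤ t ^ j := hj.pow_nonneg t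
      have h3 : 0 ≤ (-t) ^ j := hj.pow_nonneg (-t)
      have h4 : 0 ≤ c ^ (2 * p - j) :=
        ((even_two_mul p).tsub hj).pow_nonneg c
      positivity
    · rw [hj.neg_pow]
      simp
  rw [h]
  refine le_trans (le_of_eq ?_) (Finset.single_le_sum hterm
    (Finset.mem_range.2 (Nat.lt_succ_self (2 * p))))
  rw [(even_two_mul p).neg_pow]
  simp
  ring

theorem convexOn_symm_diff_le {W : ℝ → ℝ} (hW : ConvexOn ℝ Set.univ W) (c t : ℝ) {s : ℝ}
    (hs0 : 0 ≤ s) (hs1 : s ≤ 1) :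
    W (c + s * t) + W (c - s * t) ≤ W (c + t) + W (c - t) := by
  have h1 := hW.2 (Set.mem_univ (c + t)) (Set.mem_univ (c - t))
    (by linarith : 0 ≤ (1 + s) / 2) (by linarith : 0 ≤ (1 - s) / 2) (by ring)
  have h2 := hW.2 (Set.mem_univ (c + t)) (Set.mem_univ (c - t))
    (by linarith : 0 ≤ (1 - s) / 2) (by linarith : 0 ≤ (1 + s) / 2) (by ring)
  simp only [smul_eq_mul] at h1 h2
  rw [show (1 + s) / 2 * (c + t) + (1 - s) / 2 * (c - t) = c + s * t by ring] at h1
  rw [show (1 - s) / 2 * (c + t) + (1 + s) / 2 * (c - t) = c - s * t by ring] at h2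
  linarith

/-- The shift θ ↦ θ + π changes the sign of the cosine. -/
theorem integral_arcsine_symm (c h : ℝ) {f : ℝ → ℝ} (hf : Continuous f) :
    2 * ∫ x, f x ∂(arcsine c h) = (2 * Real.pi)⁻¹ * ∫ θ in (0 : ℝ)..2 * Real.pi,
      (f (c + h * Real.cos θ) + f (c - h * Real.cos θ)) := by
  rw [integral_arcsine c h hf.measurable, intervalIntegral.integral_add
    (Continuous.intervalIntegrable (by fun_prop) _ _)
    (Continuous.intervalIntegrable (by fun_prop) _ _)]
  have hper : Function.Periodic (fun θ => f (c + h * Real.cos θ)) (2 * Real.pi) := fun θ => by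
    simp [Real.cos_add_two_pi]
  have h1 : ∫ θ in (0 : ℝ)..2 * Real.pi, f (c - h * Real.cos θ)
      = ∫ θ in (0 : ℝ)..2 * Real.pi, f (c + h * Real.cos θ) := by
    have h2 := hper.intervalIntegral_add_eq 0 Real.pi
    rw [zero_add] at h2
    rw [h2, show Real.pi + 2 * Real.pi = 2 * Real.pi + Real.pi by ring]
    have h3 := intervalIntegral.integral_comp_add_right (a := 0) (b := 2 * Real.pi)
      (fun θ => f (c + h * Real.cos θ)) Real.pi
    rw [zero_add] at h3
    rw [← h3]
    simp [sub_eq_add_neg]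
  rw [h1]
  ring

/-- The equilibrium energy of the arcsine law grows at least as for the pure power field when its
interval is dilated. -/
theorem integral_arcsine_sub_ge (hV : Continuous V)
    (hc : ConvexOn ℝ Set.univ fun x : ℝ => V x - ρ * x ^ (2 * p)) (hρ : 0 ≤ ρ) (c h : ℝ) {s : ℝ}
    (hs0 : 0 ≤ s) (hs1 : s ≤ 1) :
    ρ * h ^ (2 * p) * ((Nat.choose (2 * p) p : ℝ) / 4 ^ p) * (1 - s ^ (2 * p))
      ≤ (∫ x, V x ∂(arcsine c h)) - ∫ x, V x ∂(arcsine c (s * h)) := by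
  have hpi := Real.pi_pos
  have e1 := integral_arcsine_symm c h hV
  have e2 := integral_arcsine_symm c (s * h) hV
  have hmono : ∫ θ in (0 : ℝ)..2 * Real.pi,
      (2 * ρ * h ^ (2 * p) * (1 - s ^ (2 * p)) * Real.cos θ ^ (2 * p)
        + (V (c + s * h * Real.cos θ) + V (c - s * h * Real.cos θ)))
      ≤ ∫ θ in (0 : ℝ)..2 * Real.pi, (V (c + h * Real.cos θ) + V (c - h * Real.cos θ)) := by
    refine intervalIntegral.integral_mono_on (by positivity)
      (Continuous.intervalIntegrable (by fun_prop) _ _)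
      (Continuous.intervalIntegrable (by fun_prop) _ _) fun θ _ => ?_
    have h1 := convexOn_symm_diff_le hc c (h * Real.cos θ) hs0 hs1
    have h2 := mul_le_mul_of_nonneg_left
      (two_mul_pow_le_symm_diff p c (h * Real.cos θ) hs0 hs1) hρ
    rw [mul_pow] at h2
    simp only [← mul_assoc] at h1 h2
    linarith
  rw [intervalIntegral.integral_add (Continuous.intervalIntegrable (by fun_prop) _ _)
    (Continuous.intervalIntegrable (by fun_prop) _ _), intervalIntegral.integral_const_mul,
    integral_cos_pow_two_mul] at hmono
  have h3 := mul_le_mul_of_nonneg_left hmono (by positivity : 0 ≤ (2 * Real.pi)⁻¹)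
  rw [mul_add, ← e1, ← e2] at h3
  have e3 : (2 * Real.pi)⁻¹ * (2 * ρ * h ^ (2 * p) * (1 - s ^ (2 * p))
      * (2 * Real.pi * ((Nat.choose (2 * p) p : ℝ) / 4 ^ p)))
      = 2 * (ρ * h ^ (2 * p) * ((Nat.choose (2 * p) p : ℝ) / 4 ^ p) * (1 - s ^ (2 * p))) := by
    field_simp
  rw [e3] at h3
  linarith

/-- With σ = s^{2p}, the bound log σ ≥ 1 - 1/σ gives pX(1 - σ) ≤ (1 - σ)/σ. Divide by 1 - σ and let
s → 1. -/
theorem mul_le_one_of_forall_log {X : ℝ} (hp : 1 ≤ p)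
    (h : ∀ s : ℝ, 0 < s → s < 1 → X * (1 - s ^ (2 * p)) ≤ -(2 * Real.log s)) : p * X ≤ 1 := by
  have hp0 : (0 : ℝ) < p := by exact_mod_cast hp
  have key : ∀ s : ℝ, 0 < s → s < 1 → p * X * s ^ (2 * p) ≤ 1 := by
    intro s hs0 hs1
    have hσ0 : 0 < s ^ (2 * p) := by positivity
    have hσ1 : s ^ (2 * p) < 1 := pow_lt_one₀ hs0.le hs1 (by omega)
    have h1 := Real.one_sub_inv_le_log_of_pos hσ0
    rw [Real.log_pow] at h1
    push_cast at h1
    have h2 := mul_le_mul_of_nonneg_left (h s hs0 hs1) hp0.le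
    have h3 : p * X * (1 - s ^ (2 * p)) ≤ (s ^ (2 * p))⁻¹ - 1 := by linarith
    have h4 := mul_le_mul_of_nonneg_right h3 hσ0.le
    rw [sub_mul, inv_mul_cancel₀ hσ0.ne'] at h4
    have h5 : 0 < 1 - s ^ (2 * p) := sub_pos.2 hσ1
    refine le_of_mul_le_mul_right ?_ h5
    linarith
  have hlim : Filter.Tendsto (fun s : ℝ => p * X * s ^ (2 * p)) (nhdsWithin 1 (Set.Iio 1))
      (nhds (p * X)) := by
    have : Continuous fun s : ℝ => p * X * s ^ (2 * p) := by fun_prop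
    have := this.tendsto 1
    rw [one_pow, mul_one] at this
    exact this.mono_left nhdsWithin_le_nhds
  refine le_of_tendsto hlim ?_
  filter_upwards [Ioo_mem_nhdsLT (zero_lt_one' ℝ)] with s hs using key s hs.1 hs.2

theorem arcsine_prod_log_eq [IsProbabilityMeasure μ] (hμ : Integrable (fun x => x) μ) (c : ℝ)
    {h : ℝ} (hh : 0 < h) :
    ∫ z : ℝ × ℝ, Real.log |z.1 - z.2| ∂((arcsine c h).prod μ)
      = ∫ x, ∫ y, Real.log |x - y| ∂(arcsine c h) ∂μ := by
  rw [integral_prod_log_comm, integral_prod _ (integrable_log_prod_arcsine hμ c hh)]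

/-- The half-diameter of the support of the equilibrium measure is at most the one of the field
`ρ x ^ (2 p)`. -/
theorem IsEquilibriumMeasure.half_diam_pow_le (hV : ContDiff ℝ 2 V) (hp : 1 ≤ p) (hρ : 0 < ρ)
    (hc : ConvexOn ℝ Set.univ fun x : ℝ => V x - ρ * x ^ (2 * p)) (h : IsEquilibriumMeasure V μ) :
    IsCompact μ.support ∧ 0 < Metric.diam μ.support ∧
      p * (ρ * (Metric.diam μ.support / 2) ^ (2 * p) * ((Nat.choose (2 * p) p : ℝ) / 4 ^ p))
        ≤ 1 := by
  have hμp := h.1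
  have hVc := hV.continuous
  obtain ⟨C, hC⟩ := exists_quadratic_le (hV.differentiable two_ne_zero) hp hρ hc
  have hE := h.hasFiniteEnergy hVc
  have hid := integrable_id_of_quadratic_le hρ hC hE.1
  obtain ⟨hcomp, hsub⟩ := h.isCompact_support hVc hρ hC
  obtain ⟨α, β, hα, hβ, hαβ, hdiam⟩ := diam_support hcomp
  set ℓ := (∫ x, V x ∂μ) - 2 * ∫ z : ℝ × ℝ, Real.log |z.1 - z.2| ∂(μ.prod μ) with hℓ
  have hK := Icc_subset_contactSet (convexOn_of_sub_pow hρ hc) hE.singleton hid hcomp hsub hα hβ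
  have hae : ∀ᵐ x ∂μ, x ∈ Set.Icc α β := by
    filter_upwards [Measure.support_mem_ae (μ := μ)] with x hx using hαβ hx
  have hlt : α < β := by
    refine lt_of_le_of_ne (hαβ hα).2 fun e => ?_
    have h1 : ∀ᵐ x ∂μ, x = α := by
      filter_upwards [hae] with x hx
      exact le_antisymm (e ▸ hx.2) hx.1
    have h2 := hE.singleton α
    rw [eq_dirac_of_ae_eq h1] at h2
    simp at h2
  set c := (α + β) / 2 with hc_def
  set r := (β - α) / 2 with hr_def
  have hr : 0 < r := by linarith
  have hIcc : Set.Icc (c - r) (c + r) = Set.Icc α β := by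
    rw [hc_def, hr_def]
    congr 1 <;> ring
  -- First variation towards an arcsine law, whose potential is at least log(sr/2) everywhere.
  have lower : ∀ s : ℝ, 0 < s → ℓ ≤ (∫ x, V x ∂(arcsine c (s * r))) - 2 * Real.log (s * r / 2) := by
    intro s hs
    have hsr : 0 < s * r := by positivity
    have hint := integrable_log_prod_arcsine hid c hsr
    have h1 := h.first_variation hVc (hasFiniteEnergy_arcsine hVc c hsr)
      (integrable_prod_log_comm hint)
    rw [arcsine_prod_log_eq hid c hsr] at h1
    have h2 : Real.log (s * r / 2) ≤ ∫ x, ∫ y, Real.log |x - y| ∂(arcsine c (s * r)) ∂μ := by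
      have := integral_mono (integrable_const (μ := μ) (Real.log (s * r / 2)))
        hint.integral_prod_left fun x => le_log_potential_arcsine c hsr x
      simpa using this
    linarith
  -- Average the contact inequality over the arcsine law of the convex hull; by Fubini its potential
  -- is the constant log(r/2) on the support of μ.
  have upper : (∫ x, V x ∂(arcsine c r)) - 2 * Real.log (r / 2) ≤ ℓ := by
    have hint := integrable_log_prod_arcsine hid c hr
    have hint' := integrable_prod_log_comm hint
    have h1 : ∫ x, ∫ y, Real.log |x - y| ∂(arcsine c r) ∂μ = Real.log (r / 2) := by
      have : ∫ x, ∫ y, Real.log |x - y| ∂(arcsine c r) ∂μ = ∫ _, Real.log (r / 2) ∂μ := by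
        refine integral_congr_ae ?_
        filter_upwards [hae] with x hx
        exact log_potential_arcsine c hr (hIcc ▸ hx)
      simpa using this
    rw [← arcsine_prod_log_eq hid c hr, integral_prod _ hint'] at h1
    have hVi := (hasFiniteEnergy_arcsine hVc c hr).1
    have hUi : Integrable (fun x => ∫ y, Real.log |x - y| ∂μ) (arcsine c r) :=
      hint'.integral_prod_left
    have h2 : ∫ x, (V x - 2 * ∫ y, Real.log |x - y| ∂μ) ∂(arcsine c r) ≤ ∫ _, ℓ ∂(arcsine c r) := by
      refine integral_mono_ae (hVi.sub (hUi.const_mul 2)) (integrable_const ℓ) ?_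
      filter_upwards [ae_mem_arcsine c hr.le] with x hx
      exact (hK (hIcc ▸ hx)).2
    rw [integral_sub hVi (hUi.const_mul 2), integral_const_mul, h1] at h2
    simpa using h2
  have hd2 : Metric.diam μ.support / 2 = r := by rw [hdiam]
  rw [hd2]
  refine ⟨hcomp, by rw [hdiam]; linarith, mul_le_one_of_forall_log hp fun s hs0 hs1 => ?_⟩
  have h1 := integral_arcsine_sub_ge hVc hc hρ.le c r hs0.le hs1.le
  have h2 := lower s hs0
  rw [mul_div_assoc, Real.log_mul hs0.ne' (by positivity)] at h2
  linarith

/-- The 16 is the 4 of (d/2)² times the 4 of binom(2p, p)/4^p. -/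
theorem rpow_div_le_two_div_sq {A d : ℝ} (hp : 1 ≤ p) (hA : 0 ≤ A) (hd : 0 < d)
    (h : A * (d ^ 2 / 16) ^ p ≤ 1) : A ^ (1 / (p : ℝ)) / 8 ≤ 2 / d ^ 2 := by
  have hB : 0 < d ^ 2 / 16 := by positivity
  have h1 : A ≤ ((d ^ 2 / 16)⁻¹) ^ p := by
    rw [inv_pow, ← one_div, le_div_iff₀ (by positivity)]
    exact h
  have h2 := Real.rpow_le_rpow hA h1 (by positivity : 0 ≤ 1 / (p : ℝ))
  rw [one_div, Real.pow_rpow_inv_natCast (by positivity) (by omega)] at h2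
  rw [one_div]
  have e : 2 / d ^ 2 = (d ^ 2 / 16)⁻¹ / 8 := by
    field_simp
    norm_num
  rw [e]
  linarith

theorem IsEquilibriumMeasure.poin_ge (hV : ContDiff ℝ 2 V) (hp : 1 ≤ p) (hρ : 0 < ρ)
    (hc : ConvexOn ℝ Set.univ fun x : ℝ => V x - ρ * x ^ (2 * p)) (h : IsEquilibriumMeasure V μ) :
    SatisfiesPoincare μ ∧ IsGreatest (poincareConstants μ) (Poin μ) ∧
      ((p : ℝ) * ρ * (Nat.choose (2 * p) p : ℝ)) ^ (1 / (p : ℝ)) / 8 ≤ Poin μ := by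
  have hμp := h.1
  obtain ⟨hcomp, hpos, hle⟩ := h.half_diam_pow_le hV hp hρ hc
  have hE := h.hasFiniteEnergy hV.continuous
  have hd : ∀ a : ℝ, μ ≠ Measure.dirac a := by
    rintro a rfl
    simpa using hE.singleton a
  obtain ⟨hs, hg, -, hlow⟩ := poin_of_isCompact_support hcomp hd
  refine ⟨hs, hg, (rpow_div_le_two_div_sq hp (by positivity) hpos ?_).trans hlow⟩
  refine le_trans (le_of_eq ?_) hle
  rw [pow_mul (Metric.diam μ.support / 2), div_pow (Metric.diam μ.support) 2,
    show Metric.diam μ.support ^ 2 / 16 = Metric.diam μ.support ^ 2 / 2 ^ 2 / 4 by ring,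
    div_pow _ (4 : ℝ) p]
  ring

end

end FreePoincare

theorem theorem8 :
    (∀ μ : MeasureTheory.Measure ℝ, MeasureTheory.IsProbabilityMeasure μ →
      IsCompact μ.support → (∀ a : ℝ, μ ≠ MeasureTheory.Measure.dirac a) →
        FreePoincare.SatisfiesPoincare μ ∧
        IsGreatest (FreePoincare.poincareConstants μ) (FreePoincare.Poin μ) ∧
        2 / (Metric.diam μ.support) ^ 2 ≤ FreePoincare.Poin μ ∧
        FreePoincare.Poin μ ≤ 1 / ProbabilityTheory.variance (fun x : ℝ => x) μ ∧
        (2 / (Metric.diam μ.support) ^ 2 = FreePoincare.Poin μ ↔ FreePoincare.IsTwoPoint μ) ∧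
        (FreePoincare.Poin μ = 1 / ProbabilityTheory.variance (fun x : ℝ => x) μ ↔
          FreePoincare.IsSemicircular μ)) ∧
    (∀ (V : ℝ → ℝ) (p : ℕ) (ρ : ℝ) (μ : MeasureTheory.Measure ℝ),
      ContDiff ℝ 2 V → 1 ≤ p → 0 < ρ →
      ConvexOn ℝ Set.univ (fun x : ℝ => V x - ρ * x ^ (2 * p)) →
      FreePoincare.IsEquilibriumMeasure V μ →
        FreePoincare.SatisfiesPoincare μ ∧
        IsGreatest (FreePoincare.poincareConstants μ) (FreePoincare.Poin μ) ∧
        ((p : ℝ) * ρ * (Nat.choose (2 * p) p : ℝ)) ^ (1 / (p : ℝ)) / 8 ≤ FreePoincare.Poin μ ∧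
        (p = 1 → ρ / 4 ≤ FreePoincare.Poin μ)) := by
  refine ⟨fun μ _ hc hd => ?_, fun V p ρ μ hV hp hρ hconv hμ => ?_⟩
  · obtain ⟨hs, hg, -, hle⟩ := FreePoincare.poin_of_isCompact_support hc hd
    exact ⟨hs, hg, hle, FreePoincare.poin_le_inv_variance hc Measure.support_mem_ae
      (FreePoincare.variance_id_pos hc Measure.support_mem_ae hd) hg.1.2,
      FreePoincare.two_div_diam_sq_eq_poin_iff hc hd,
      FreePoincare.poin_eq_one_div_variance_iff hc hd⟩
  · obtain ⟨hs, hg, hle⟩ := hμ.poin_ge hV hp hρ hconv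
    refine ⟨hs, hg, hle, ?_⟩
    rintro rfl
    -- For p = 1 the binomial coefficient is 2, and 2ρ/8 = ρ/4.
    refine le_trans (le_of_eq ?_) hle
    simp
    ring
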